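/- Fix an effective enumeration of the rational numbers and of the rational open intervals $I_0, I_1, \dots$ of $\mathbb{R}$, and the usual indexing of partial computable functions, c.e. sets and Turing functionals. A Cauchy name of $x \in \mathbb{R}$ is a sequence of rationals $(q_n)$ with $|q_n - q_{n+1}| < 2^{-n}$ for all $n$ and $\lim_n q_n = x$. An index of a computable real is an index of a computable Cauchy name of it. An index of a computable function $f : \mathbb{R} \to \mathbb{R}$ is an index of a Turing functional that maps each Cauchy name of each $x \in \mathbb{R}$ to a Cauchy name of $f(x)$. A compact-open name of a continuous $f : \mathbb{R} \to \mathbb{R}$ is an enumeration of all pairs $(I, J)$ of a compact rational interval $I$ and an open rational interval $J$ with $f[I] \subseteq J$. An index of an open $U \subseteq \mathbb{R}$ with $\{i : I_i \subseteq U\}$ c.e. is an index of that c.e. set. A sequence $(\mu_n)_{n \in \mathbb{N}}$ of finite Borel measures on $\mathbb{R}$ is uniformly computable if one can compute an index of the real $\mu_n(\mathbb{R})$ from $n$, and an index of the c.e. left Dedekind cut of $\mu_n(U)$ from $n$ and any index of any open $U$ with $\{i : I_i \subseteq U\}$ c.e. A modulus of convergence of a real sequence $(a_n)$ with limit $a$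 is a function $g : \mathbb{N} \to \mathbb{N}$ such that $|a_n - a| < 2^{-k}$ whenever $n \ge g(k)$. Let $\mu$ be a finite Borel measure on $\mathbb{R}$. * $(\mu_n)$ effectively weakly converges to $\mu$ if $\lim_n \int f \, d\mu_n = \int f \, d\mu$ for every bounded computable $f : \mathbb{R} \to \mathbb{R}$, and one can compute, from any index of such an $f$ and any $B \in \mathbb{N}$ with $|f| \le B$, an index of a modulus of convergence of $(\int f \, d\mu_n)_n$. * $(\mu_n)$ uniformly effectively weakly converges to $\mu$ if it weakly converges to $\mu$, and there is one Turing functional that, for every bounded continuous $f : \mathbb{R} \to \mathbb{R}$, computes a modulus of convergence of $(\int f \, d\mu_n)_n$ from any compact-open name of $f$ and any $B \in \mathbb{N}$ with $|f| \le B$. **Theorem.** Let $(\mu_n)_{n \in \mathbb{N}}$ be a uniformly computable sequence of finite Borel measures on $\mathbb{R}$. For every finite Borel measure $\mu$ on $\mathbb{R}$, $(\mu_n)$ effectively weakly converges to $\mu$ if and only if it uniformly effectively weakly converges to $\mu$. In particular, $(\mu_n)$ is effectively weakly convergent (to some $\mu$) if and only if it is uniformly effectively weakly convergent (to some $\mu$).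 -/

import Mathlib

open Filter Topology MeasureTheory
open Nat.Partrec (Code)

namespace EffWeak

/-! ### Computability on the natural numbers and on Baire space

Programs are Mathlib's codes `Nat.Partrec.Code` (effectively numbered by `ℕ`); they serve as
indices. -/

/-- `c` is an index of the total function `g`. -/
def Computes (c : Code) (g : ℕ → ℕ) : Prop :=
  ∀ n, g n ∈ c.eval n

/-- `c` is an index of the c.e. set `S`: the set `S` is the domain of the partial recursive
function computed by `c`. -/
def IndexesCE (c : Code) (S : Set ℕ) : Prop :=
  ∀ i, i ∈ S ↔ (c.eval i).Dom

/-- The finite initial segment `ρ 0, …, ρ (k - 1)` of the oracle `ρ`. -/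
def initSeg (ρ : ℕ → ℕ) (k : ℕ) : List ℕ :=
  (List.range k).map ρ

/-- The Turing functional with index `c`, applied to the oracle `ρ`.  On input `n`, all
computations of `c` on pairs `(initial segment of ρ, n)` are dovetailed (the pair `(s, k)` decoded
from `t` stands for `s` steps of the computation that sees the segment of length `k`), and the
output found first is returned.

Every such functional is computed by an oracle Turing machine.  Conversely, an oracle machine
is of this form: let `c`, on `(σ, n)`, run the machine on `n` for `σ.length` steps, answer its
queries from `σ`, and output the result if the machine halts in time without a query beyond `σ`. -/
def functional (c : Code) (ρ : ℕ → ℕ) : ℕ →. ℕ := fun n =>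
  Nat.rfindOpt fun t =>
    c.evaln t.unpair.1 (Nat.pair (Encodable.encode (initSeg ρ t.unpair.2)) n)

/-! ### Names of reals and of functions -/

/-- An effective enumeration (with repetitions) of the rational numbers. -/
def rat (m : ℕ) : ℚ :=
  ((m.unpair.1.unpair.1 : ℚ) - (m.unpair.1.unpair.2 : ℚ)) / ((m.unpair.2 : ℚ) + 1)

/-- The open rational interval `I_i`; all open rational intervals are enumerated (also the empty
one). -/
def openInterval (i : ℕ) : Set ℝ :=
  Set.Ioo (rat i.unpair.1 : ℝ) (rat i.unpair.2 : ℝ)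

/-- `ρ` codes a Cauchy name of the real `x`. -/
def IsCauchyName (ρ : ℕ → ℕ) (x : ℝ) : Prop :=
  (∀ n, |rat (ρ n) - rat (ρ (n + 1))| < (2 : ℚ)⁻¹ ^ n) ∧
    Tendsto (fun n => (rat (ρ n) : ℝ)) atTop (𝓝 x)

/-- `m` codes a pair of a compact rational interval `I = [a, b]`, with `a ≤ b`, and an open
rational interval `J` such that `f` lies in `N_{I,J}`, that is, `f[I] ⊆ J`. -/
def MemSubbasic (f : ℝ → ℝ) (m : ℕ) : Prop :=
  rat m.unpair.1.unpair.1 ≤ rat m.unpair.1.unpair.2 ∧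
    f '' Set.Icc (rat m.unpair.1.unpair.1 : ℝ) (rat m.unpair.1.unpair.2 : ℝ) ⊆
      openInterval m.unpair.2

/-- `ρ` is a compact-open name of `f`: an enumeration of the (codes of the) subbasic
compact-open neighbourhoods `N_{I,J}` that contain `f`. -/
def IsCompactOpenName (ρ : ℕ → ℕ) (f : ℝ → ℝ) : Prop :=
  Set.range ρ = {m | MemSubbasic f m}

/-- `c` is an index of the computable real `x`: it computes a Cauchy name of `x`. -/
def IndexesReal (c : Code) (x : ℝ) : Prop :=
  ∃ ρ : ℕ → ℕ, Computes c ρ ∧ IsCauchyName ρ x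

/-- `c` is an index of the left-c.e. real `x`: an index of its left Dedekind cut. -/
def IndexesLeftCut (c : Code) (x : ℝ) : Prop :=
  IndexesCE c {i | (rat i : ℝ) < x}

/-- `c` is an index of the open set `U ∈ Σ⁰₁(ℝ)`. -/
def IndexesOpen (c : Code) (U : Set ℝ) : Prop :=
  IsOpen U ∧ IndexesCE c {i | openInterval i ⊆ U}

/-- `c` is an index of the computable function `f : ℝ → ℝ`: its Turing functional maps every
Cauchy name of every real `x` to a Cauchy name of `f x`. -/
def IndexesFunction (c : Code) (f : ℝ → ℝ) : Prop :=
  ∀ (x : ℝ) (ρ : ℕ → ℕ), IsCauchyName ρ x →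
    ∃ σ : ℕ → ℕ, (∀ n, σ n ∈ functional c ρ n) ∧ IsCauchyName σ (f x)

/-! ### Measures -/

/-- A uniformly computable sequence of finite Borel measures on `ℝ`: an index of the real `μ_n(ℝ)`
can be computed from `n`, and an index of the left cut of `μ_n(U)` can be computed from `n` and any
index of any `U ∈ Σ⁰₁(ℝ)`. -/
def UniformlyComputable (μs : ℕ → FiniteMeasure ℝ) : Prop :=
  (∃ t : ℕ →. Code, Partrec t ∧
    ∀ n, ∃ c ∈ t n, IndexesReal c ((μs n : Measure ℝ).real Set.univ)) ∧
  (∃ h : ℕ × Code →. Code, Partrec h ∧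
    ∀ (n : ℕ) (U : Set ℝ) (e : Code), IndexesOpen e U →
      ∃ c ∈ h (n, e), IndexesLeftCut c ((μs n : Measure ℝ).real U))

/-- `g` is a modulus of convergence of the sequence `a` with limit `l`. -/
def IsModulus (g : ℕ → ℕ) (a : ℕ → ℝ) (l : ℝ) : Prop :=
  ∀ k n, g k ≤ n → |a n - l| < (2 : ℝ)⁻¹ ^ k

/-- `μs` effectively weakly converges to `μ`: for every bounded computable `f`, the integrals
converge, and an index of a modulus of convergence can be computed (by one procedure `h`) from
an index of `f` and a bound on `|f|`. -/
def EffectivelyWeaklyConverges (μs : ℕ → FiniteMeasure ℝ) (μ : FiniteMeasure ℝ) : Prop :=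
  (∀ (f : ℝ → ℝ) (e : Code) (B : ℕ), IndexesFunction e f → (∀ x, |f x| ≤ B) →
    Tendsto (fun n => ∫ x, f x ∂(μs n : Measure ℝ)) atTop (𝓝 (∫ x, f x ∂(μ : Measure ℝ)))) ∧
  ∃ h : Code × ℕ →. Code, Partrec h ∧
    ∀ (f : ℝ → ℝ) (e : Code) (B : ℕ), IndexesFunction e f → (∀ x, |f x| ≤ B) →
      ∃ c ∈ h (e, B), ∃ g : ℕ → ℕ, Computes c g ∧
        IsModulus g (fun n => ∫ x, f x ∂(μs n : Measure ℝ)) (∫ x, f x ∂(μ : Measure ℝ))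

/-- `μs` uniformly effectively weakly converges to `μ`: it weakly converges to `μ` (Mathlib's
topology on `FiniteMeasure ℝ` is that of weak convergence), and a single Turing functional,
with a compact-open name of any bounded continuous `f` as its oracle, computes a
modulus of convergence `g` of the integrals from a bound `B` on `|f|` (it maps `(B, k)` to `g k`). -/
def UniformlyEffectivelyWeaklyConverges (μs : ℕ → FiniteMeasure ℝ) (μ : FiniteMeasure ℝ) : Prop :=
  Tendsto μs atTop (𝓝 μ) ∧
  ∃ c : Code, ∀ (f : ℝ → ℝ) (ρ : ℕ → ℕ) (B : ℕ), Continuous f → IsCompactOpenName ρ f →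
    (∀ x, |f x| ≤ B) →
      ∃ g : ℕ → ℕ, (∀ k, g k ∈ functional c ρ (Nat.pair B k)) ∧
        IsModulus g (fun n => ∫ x, f x ∂(μs n : Measure ℝ)) (∫ x, f x ∂(μ : Measure ℝ))

end EffWeak

/-!
A finite amount of information about a bounded continuous `f` is enough to control its integrals
up to a given error: the values of `f` on a compact interval up to a small error, a bound for
`|f|`, and an interval outside of which the measures have little mass.

For *effective implies uniform*, a countable family of test functions carries this information:
`testFun (B, L, ℓ)`, the lower envelope of finitely many functions `x ↦ c + L * |x - a|` with
rational `c` and `a`, cut off at `-B` and `B`.  Test functions are `L`-Lipschitz and computable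
uniformly in their codes (`exists_testFun_index`), they are dense (`exists_testFun_approx`), and
they include the constant `1` and, up to an affine change, the cut-off functions `tail N`.  Hence
effective weak convergence yields moduli for all of them, computably in the code
(`EffectivelyWeaklyConverges.exists_testFun_modulus`).  As the sequence is uniformly computable,
one can semidecide that `μ_n` has little mass outside `(-N, N)`
(`UniformlyComputable.exists_semidecision`); by the moduli of `tail (N + 1)` and of `1`, this then
holds at all later times and for the limit (`integral_tail_lt_of_modulus`).  A functional with a
compact-open name of `f` as its oracle searches for such an `N` and `n`, and for a test function
that the name shows to be close to `f` on `[-(N + 2), N + 2]` (`IsClose`); the modulus of this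
test function, past `n`, is a modulus for `f` (`abs_integral_sub_lt_of_isClose`).  The search
succeeds because convergence on test functions implies tightness
(`exists_eventually_measureReal_compl_lt`) and by density (`exists_isClose`).  Since every bounded
continuous function has a compact-open name, the moduli also give weak convergence.

For *uniform implies effective*, a compact-open name of a computable `f` is computed from an index
of `f`.  A halting computation reads only a finite part of a Cauchy name, so its output
approximates `f` on a whole neighbourhood (`IsLocalCert.abs_sub_le`).  By compactness, `f[I] ⊆ J`
holds exactly when finitely many such computations confirm it (`IsCover.memSubbasic`,
`exists_isCover`), and checking a finite certificate is primitive recursive.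
-/

namespace EffWeak

/-! ### Arithmetic on codes of rationals -/

/-- The code of `(a - b) / (d + 1)`. -/
def ratMk (a b d : ℕ) : ℕ := Nat.pair (Nat.pair a b) d

theorem rat_ratMk (a b d : ℕ) : rat (ratMk a b d) = ((a : ℚ) - b) / ((d : ℚ) + 1) := by
  simp [rat, ratMk]

theorem rat_surjective : Function.Surjective rat := by
  intro q
  refine ⟨ratMk q.num.toNat (-q.num).toNat (q.den - 1), ?_⟩
  rw [rat_ratMk]
  have h1 : ((q.den - 1 : ℕ) : ℚ) + 1 = q.den := by
    have := q.den_pos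
    exact_mod_cast Nat.sub_add_cancel this
  have h2 : ((q.num.toNat : ℕ) : ℚ) - ((-q.num).toNat : ℕ) = q.num := by
    have : ((q.num.toNat : ℕ) : ℤ) - ((-q.num).toNat : ℕ) = q.num := Int.toNat_sub_toNat_neg _
    exact_mod_cast this
  rw [h1, h2, Rat.num_div_den]

/-- Sum of rationals, on codes. -/
def ratAdd (m n : ℕ) : ℕ :=
  ratMk (m.unpair.1.unpair.1 * (n.unpair.2 + 1) + n.unpair.1.unpair.1 * (m.unpair.2 + 1))
    (m.unpair.1.unpair.2 * (n.unpair.2 + 1) + n.unpair.1.unpair.2 * (m.unpair.2 + 1))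
    ((m.unpair.2 + 1) * (n.unpair.2 + 1) - 1)

/-- Negation of a rational, on codes. -/
def ratNeg (m : ℕ) : ℕ := ratMk m.unpair.1.unpair.2 m.unpair.1.unpair.1 m.unpair.2

/-- Product of a natural number and a rational, on codes. -/
def ratNsmul (L m : ℕ) : ℕ :=
  ratMk (L * m.unpair.1.unpair.1) (L * m.unpair.1.unpair.2) m.unpair.2

/-- The code of `2⁻¹ ^ n`. -/
def ratHalfPow (n : ℕ) : ℕ := ratMk 1 0 (2 ^ n - 1)

theorem rat_ratAdd (m n : ℕ) : rat (ratAdd m n) = rat m + rat n := by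
  have h : (((m.unpair.2 + 1) * (n.unpair.2 + 1) - 1 : ℕ) : ℚ) + 1
      = (m.unpair.2 + 1) * (n.unpair.2 + 1) := by
    exact_mod_cast Nat.sub_add_cancel (show 1 ≤ (m.unpair.2 + 1) * (n.unpair.2 + 1) from
      Nat.mul_pos (Nat.succ_pos _) (Nat.succ_pos _))
  rw [ratAdd, rat_ratMk, h, rat, rat]
  push_cast
  field_simp
  ring

theorem rat_ratNeg (m : ℕ) : rat (ratNeg m) = -rat m := by
  rw [ratNeg, rat_ratMk, rat]; ring

theorem rat_ratNsmul (L m : ℕ) : rat (ratNsmul L m) = L * rat m := by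
  rw [ratNsmul, rat_ratMk, rat]; push_cast; ring

theorem rat_ratHalfPow (n : ℕ) : rat (ratHalfPow n) = (2 : ℚ)⁻¹ ^ n := by
  have h : ((2 ^ n - 1 : ℕ) : ℚ) + 1 = 2 ^ n := by
    exact_mod_cast Nat.sub_add_cancel (Nat.one_le_two_pow (n := n))
  rw [ratHalfPow, rat_ratMk, h]; simp

theorem rat_lt_iff (m n : ℕ) : rat m < rat n ↔
    m.unpair.1.unpair.1 * (n.unpair.2 + 1) + n.unpair.1.unpair.2 * (m.unpair.2 + 1) <
    n.unpair.1.unpair.1 * (m.unpair.2 + 1) + m.unpair.1.unpair.2 * (n.unpair.2 + 1) := by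
  rw [rat, rat, div_lt_div_iff₀ (by positivity) (by positivity), ← Nat.cast_lt (α := ℚ)]
  push_cast
  constructor <;> intro h <;> linarith

/-- Maximum of rationals, on codes. -/
def ratMax (m n : ℕ) : ℕ := if rat m < rat n then n else m

/-- Minimum of rationals, on codes. -/
def ratMin (m n : ℕ) : ℕ := if rat m < rat n then m else n

theorem rat_ratMax (m n : ℕ) : rat (ratMax m n) = max (rat m) (rat n) := by
  unfold ratMax
  split_ifs with h
  · exact (max_eq_right h.le).symm
  · exact (max_eq_left (not_lt.1 h)).symm

theorem rat_ratMin (m n : ℕ) : rat (ratMin m n) = min (rat m) (rat n) := by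
  unfold ratMin
  split_ifs with h
  · exact (min_eq_left h.le).symm
  · exact (min_eq_right (not_lt.1 h)).symm

theorem primrec_natPow : Primrec₂ ((· ^ ·) : ℕ → ℕ → ℕ) :=
  Primrec₂.unpaired'.1 Nat.Primrec.pow

section Primrec

variable {α : Type*} [Primcodable α]

theorem primrec_unpairFst {f : α → ℕ} (hf : Primrec f) : Primrec fun a => (f a).unpair.1 :=
  Primrec.fst.comp (Primrec.unpair.comp hf)

theorem primrec_unpairSnd {f : α → ℕ} (hf : Primrec f) : Primrec fun a => (f a).unpair.2 :=
  Primrec.snd.comp (Primrec.unpair.comp hf)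

theorem primrec_add {f g : α → ℕ} (hf : Primrec f) (hg : Primrec g) :
    Primrec fun a => f a + g a := Primrec.nat_add.comp hf hg

theorem primrec_mul {f g : α → ℕ} (hf : Primrec f) (hg : Primrec g) :
    Primrec fun a => f a * g a := Primrec.nat_mul.comp hf hg

theorem primrec_addConst {f : α → ℕ} (hf : Primrec f) (n : ℕ) : Primrec fun a => f a + n :=
  primrec_add hf (Primrec.const n)

theorem primrec_ratMk {f g h : α → ℕ} (hf : Primrec f) (hg : Primrec g) (hh : Primrec h) :
    Primrec fun a => ratMk (f a) (g a) (h a) :=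
  Primrec₂.natPair.comp (Primrec₂.natPair.comp hf hg) hh

theorem primrec_ratAdd {f g : α → ℕ} (hf : Primrec f) (hg : Primrec g) :
    Primrec fun a => ratAdd (f a) (g a) := by
  have hf1 := primrec_unpairFst (primrec_unpairFst hf)
  have hf2 := primrec_unpairSnd (primrec_unpairFst hf)
  have hf3 := primrec_addConst (primrec_unpairSnd hf) 1
  have hg1 := primrec_unpairFst (primrec_unpairFst hg)
  have hg2 := primrec_unpairSnd (primrec_unpairFst hg)
  have hg3 := primrec_addConst (primrec_unpairSnd hg) 1
  exact primrec_ratMk (primrec_add (primrec_mul hf1 hg3) (primrec_mul hg1 hf3))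
    (primrec_add (primrec_mul hf2 hg3) (primrec_mul hg2 hf3))
    (Primrec.nat_sub.comp (primrec_mul hf3 hg3) (Primrec.const 1))

theorem primrec_ratNeg {f : α → ℕ} (hf : Primrec f) : Primrec fun a => ratNeg (f a) :=
  primrec_ratMk (primrec_unpairSnd (primrec_unpairFst hf))
    (primrec_unpairFst (primrec_unpairFst hf)) (primrec_unpairSnd hf)

theorem primrec_ratNsmul {f g : α → ℕ} (hf : Primrec f) (hg : Primrec g) :
    Primrec fun a => ratNsmul (f a) (g a) :=
  primrec_ratMk (primrec_mul hf (primrec_unpairFst (primrec_unpairFst hg)))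
    (primrec_mul hf (primrec_unpairSnd (primrec_unpairFst hg))) (primrec_unpairSnd hg)

theorem primrec_ratHalfPow {f : α → ℕ} (hf : Primrec f) : Primrec fun a => ratHalfPow (f a) :=
  primrec_ratMk (Primrec.const 1) (Primrec.const 0)
    (Primrec.nat_sub.comp (primrec_natPow.comp (Primrec.const 2) hf) (Primrec.const 1))

theorem primrecPred_ratLt {f g : α → ℕ} (hf : Primrec f) (hg : Primrec g) :
    PrimrecPred fun a => rat (f a) < rat (g a) := by
  have hf1 := primrec_unpairFst (primrec_unpairFst hf)
  have hf2 := primrec_unpairSnd (primrec_unpairFst hf)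
  have hf3 := primrec_addConst (primrec_unpairSnd hf) 1
  have hg1 := primrec_unpairFst (primrec_unpairFst hg)
  have hg2 := primrec_unpairSnd (primrec_unpairFst hg)
  have hg3 := primrec_addConst (primrec_unpairSnd hg) 1
  exact (Primrec.nat_lt.comp (primrec_add (primrec_mul hf1 hg3) (primrec_mul hg2 hf3))
    (primrec_add (primrec_mul hg1 hf3) (primrec_mul hf2 hg3))).of_eq
      fun a => (rat_lt_iff _ _).symm

theorem primrec_ratMax {f g : α → ℕ} (hf : Primrec f) (hg : Primrec g) :
    Primrec fun a => ratMax (f a) (g a) :=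
  Primrec.ite (primrecPred_ratLt hf hg) hg hf

theorem primrec_ratMin {f g : α → ℕ} (hf : Primrec f) (hg : Primrec g) :
    Primrec fun a => ratMin (f a) (g a) :=
  Primrec.ite (primrecPred_ratLt hf hg) hf hg

theorem primrecPred_forall_lt {p : α → ℕ → Prop} {b : α → ℕ}
    (hp : PrimrecPred fun q : α × ℕ => p q.1 q.2) (hb : Primrec b) :
    PrimrecPred fun a => ∀ i < b a, p a i :=
  ((PrimrecRel.forall_mem_list (R := fun (i : ℕ) (a : α) => p a i)
    (hp.comp (Primrec.pair Primrec.snd Primrec.fst))).comp (Primrec.list_range.comp hb)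
      Primrec.id).of_eq fun a => by simp

end Primrec

/-! ### Indices and effective choice -/

section Indices

variable {α : Type*} [Primcodable α]

/-- Every partial recursive function between encodable types has an index. -/
theorem exists_code_of_partrec {β : Type*} [Primcodable β] {f : α →. β} (hf : Partrec f) :
    ∃ c : Code, ∀ a, c.eval (Encodable.encode a) = (f a).map Encodable.encode := by
  obtain ⟨c, hc⟩ := Nat.Partrec.Code.exists_code.1 hf
  refine ⟨c, fun a => ?_⟩
  rw [hc]
  change ((Encodable.decode (Encodable.encode a) : Option α) : Part α).bind _ = _
  rw [Encodable.encodek]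
  exact Part.bind_some _ _

/-- The s-m-n theorem for a family of partial recursive functions with parameters in `α`. -/
theorem exists_computable_index {F : α → ℕ →. ℕ} (hF : Partrec₂ F) :
    ∃ s : α → Code, Computable s ∧ ∀ a n, (s a).eval n = F a n := by
  obtain ⟨c, hc⟩ := exists_code_of_partrec hF
  refine ⟨fun a => c.curry (Encodable.encode a),
    (Nat.Partrec.Code.primrec₂_curry.comp (Primrec.const c) Primrec.encode).to_comp, fun a n => ?_⟩
  rw [Nat.Partrec.Code.eval_curry]
  exact (hc (a, n)).trans (Part.map_id' (fun _ => rfl) _)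

/-- Effective choice: by dovetailing, a value of some `G a w` is found whenever there is one. -/
theorem exists_partrec_select {β : Type*} [Primcodable β] {G : α → ℕ →. β} (hG : Partrec₂ G) :
    ∃ F : α →. β, Partrec F ∧ (∀ a, ∀ b ∈ F a, ∃ w, b ∈ G a w) ∧
      ∀ a w, (G a w).Dom → (F a).Dom := by
  obtain ⟨c, hc⟩ := exists_code_of_partrec hG
  have hev : ∀ a w, c.eval (Encodable.encode (a, w)) = (G a w).map Encodable.encode :=
    fun a w => hc (a, w)
  refine ⟨fun a => Nat.rfindOpt fun t =>
    (c.evaln t.unpair.1 (Encodable.encode (a, t.unpair.2))).bind Encodable.decode, ?_, ?_, ?_⟩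
  · refine Partrec.rfindOpt (Primrec.to_comp ?_)
    have h2 : Primrec fun p : α × ℕ => p.2 := Primrec.snd
    refine Primrec.option_bind
      (Nat.Partrec.Code.primrec_evaln.comp (Primrec.pair (Primrec.pair (primrec_unpairFst h2)
        (Primrec.const c)) (Primrec.encode.comp (Primrec.pair Primrec.fst (primrec_unpairSnd h2)))))
      (Primrec.decode.comp Primrec.snd)
  · intro a b hb
    obtain ⟨t, ht⟩ := Nat.rfindOpt_spec hb
    obtain ⟨y, hy, hyb⟩ := Option.bind_eq_some_iff.1 (Option.mem_def.1 ht)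
    have := Nat.Partrec.Code.evaln_sound (Option.mem_def.2 hy)
    rw [hev] at this
    obtain ⟨b', hb', rfl⟩ := (Part.mem_map_iff _).1 this
    rw [Encodable.encodek] at hyb
    cases hyb
    exact ⟨_, hb'⟩
  · intro a w hd
    obtain ⟨b, hb⟩ := Part.dom_iff_mem.1 hd
    have : Encodable.encode b ∈ c.eval (Encodable.encode (a, w)) := by
      rw [hev]; exact Part.mem_map _ hb
    obtain ⟨k, hk⟩ := Nat.Partrec.Code.evaln_complete.1 this
    refine Nat.rfindOpt_dom.2 ⟨Nat.pair k w, b, ?_⟩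
    simp only [Nat.unpair_pair]
    rw [Option.mem_def.1 hk]
    simp

end Indices

/-! ### Turing functionals -/

theorem initSeg_congr {ρ ρ' : ℕ → ℕ} {k : ℕ} (h : ∀ i < k, ρ i = ρ' i) :
    initSeg ρ k = initSeg ρ' k := by
  unfold initSeg
  exact List.map_congr_left fun i hi => h i (List.mem_range.1 hi)

theorem mem_functional_imp {c : Code} {ρ : ℕ → ℕ} {n y : ℕ} (h : y ∈ functional c ρ n) :
    ∃ k, y ∈ c.eval (Nat.pair (Encodable.encode (initSeg ρ k)) n) := by
  obtain ⟨t, ht⟩ := Nat.rfindOpt_spec h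
  exact ⟨_, Nat.Partrec.Code.evaln_sound ht⟩

theorem functional_dom {c : Code} {ρ : ℕ → ℕ} {n k : ℕ}
    (h : (c.eval (Nat.pair (Encodable.encode (initSeg ρ k)) n)).Dom) :
    (functional c ρ n).Dom := by
  obtain ⟨y, hy⟩ := Part.dom_iff_mem.1 h
  obtain ⟨s, hs⟩ := Nat.Partrec.Code.evaln_complete.1 hy
  exact Nat.rfindOpt_dom.2 ⟨Nat.pair s k, y, by simpa using hs⟩

/-- A partial recursive `F a` on pairs (finite oracle segment, input) defines a functional, with an
index computable from `a`, whose outputs are outputs of `F a`, and which is defined once `F a` is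
defined on some segment. -/
theorem exists_functional_index {α : Type*} [Primcodable α] {F : α → List ℕ × ℕ →. ℕ}
    (hF : Partrec₂ F) :
    ∃ s : α → Code, Computable s ∧ ∀ a ρ n,
      (∀ y ∈ functional (s a) ρ n, ∃ k, y ∈ F a (initSeg ρ k, n)) ∧
      ∀ k, (F a (initSeg ρ k, n)).Dom → (functional (s a) ρ n).Dom := by
  have hdec : Computable fun p : α × ℕ => (Encodable.decode (α := List ℕ × ℕ) p.2) :=
    Computable.decode.comp Computable.snd
  have hG : Partrec₂ fun (a : α) (z : ℕ) =>
      ((Encodable.decode (α := List ℕ × ℕ) z : Option _) : Part (List ℕ × ℕ)).bind (F a) := by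
    refine Partrec.bind hdec.ofOption ?_
    exact hF.comp (Computable.fst.comp Computable.fst) Computable.snd
  obtain ⟨s, hs, hev⟩ := exists_computable_index hG
  have hev' : ∀ a σ n, (s a).eval (Nat.pair (Encodable.encode σ) n) = F a (σ, n) := by
    intro a σ n
    have : Nat.pair (Encodable.encode σ) n = Encodable.encode (σ, n) := by simp
    rw [hev, this, Encodable.encodek]
    exact Part.bind_some _ _
  refine ⟨s, hs, fun a ρ n => ⟨fun y hy => ?_, fun k hk => ?_⟩⟩
  · obtain ⟨k, hk⟩ := mem_functional_imp hy
    exact ⟨k, hev' _ _ _ ▸ hk⟩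
  · exact functional_dom (k := k) (by rw [hev']; exact hk)

theorem IsCauchyName.dist_le {ρ : ℕ → ℕ} {x : ℝ} (h : IsCauchyName ρ x) (n : ℕ) :
    |(rat (ρ n) : ℝ) - x| ≤ 2 * (2 : ℝ)⁻¹ ^ n := by
  have h1 : ∀ n, dist ((rat (ρ n) : ℝ)) (rat (ρ (n + 1))) ≤ 1 * (2 : ℝ)⁻¹ ^ n := by
    intro n
    have := h.1 n
    rw [Real.dist_eq, one_mul]
    have h2 : ((|rat (ρ n) - rat (ρ (n + 1))| : ℚ) : ℝ) < (((2 : ℚ)⁻¹ ^ n : ℚ) : ℝ) := by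
      exact_mod_cast this
    push_cast at h2
    exact h2.le
  have := dist_le_of_le_geometric_of_tendsto (2 : ℝ)⁻¹ 1 (by norm_num) h1 h.2 n
  rw [Real.dist_eq] at this
  refine this.trans (le_of_eq ?_)
  norm_num
  ring

/-- Closeness to the limit, with room for two consecutive errors, implies the condition on
consecutive terms of a Cauchy name. -/
theorem isCauchyName_of_dist_le {ρ : ℕ → ℕ} {x : ℝ}
    (h : ∀ n, |(rat (ρ n) : ℝ) - x| ≤ (2 : ℝ)⁻¹ ^ (n + 2)) : IsCauchyName ρ x := by
  constructor
  · intro n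
    have h1 := abs_le.1 (h n)
    have h2 := abs_le.1 (h (n + 1))
    have h3 : (0 : ℝ) < (2 : ℝ)⁻¹ ^ n := by positivity
    have h4 : ((|rat (ρ n) - rat (ρ (n + 1))| : ℚ) : ℝ) < (((2 : ℚ)⁻¹ ^ n : ℚ) : ℝ) := by
      push_cast
      simp only [pow_succ] at h1 h2
      rw [abs_lt]
      constructor <;> linarith
    exact_mod_cast h4
  · rw [tendsto_iff_dist_tendsto_zero]
    refine squeeze_zero (g := fun n => (2 : ℝ)⁻¹ ^ (n + 2)) (fun _ => dist_nonneg) h ?_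
    exact (tendsto_pow_atTop_nhds_zero_of_lt_one (r := (2 : ℝ)⁻¹) (by norm_num)
      (by norm_num)).comp (tendsto_add_atTop_nat 2)

/-! ### Lipschitz test functions -/

/-- A finite code `(B, L, ℓ)` of a test function: a bound `B`, a Lipschitz constant `L`, and a list
`ℓ` of pairs of codes of rationals. -/
abbrev TestCode : Type := ℕ × ℕ × List (ℕ × ℕ)

/-- The lower envelope of the constant `B` and of the functions `x ↦ c + L * |x - a|`, where
`(c, a)` runs through `ℓ`. -/
def envelope (B L : ℕ) (ℓ : List (ℕ × ℕ)) (x : ℝ) : ℝ :=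
  ℓ.foldr (fun q y => min ((rat q.1 : ℝ) + L * |x - (rat q.2 : ℝ)|) y) B

/-- The test function with code `p = (B, L, ℓ)`: the envelope, cut off below at `-B`. -/
def testFun (p : TestCode) (x : ℝ) : ℝ :=
  max (-(p.1 : ℝ)) (envelope p.1 p.2.1 p.2.2 x)

theorem le_envelope_iff {B L : ℕ} {ℓ : List (ℕ × ℕ)} {x y : ℝ} :
    y ≤ envelope B L ℓ x ↔ y ≤ B ∧ ∀ q ∈ ℓ, y ≤ (rat q.1 : ℝ) + L * |x - (rat q.2 : ℝ)| := by
  induction ℓ with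
  | nil => simp [envelope]
  | cons q ℓ ih =>
    have h : envelope B L (q :: ℓ) x
        = min ((rat q.1 : ℝ) + L * |x - (rat q.2 : ℝ)|) (envelope B L ℓ x) := rfl
    rw [h, le_min_iff, ih, List.forall_mem_cons]
    tauto

theorem abs_testFun_le (p : TestCode) (x : ℝ) : |testFun p x| ≤ p.1 := by
  have h0 : (0 : ℝ) ≤ p.1 := Nat.cast_nonneg _
  have h1 : envelope p.1 p.2.1 p.2.2 x ≤ p.1 := (le_envelope_iff.1 le_rfl).1
  exact abs_le.2 ⟨le_max_left _ _, max_le (by linarith) h1⟩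

theorem abs_testFun_sub_le (p : TestCode) (x y : ℝ) :
    |testFun p x - testFun p y| ≤ p.2.1 * |x - y| := by
  obtain ⟨B, L, ℓ⟩ := p
  have key : ∀ x y, envelope B L ℓ x - L * |x - y| ≤ envelope B L ℓ y := by
    intro x y
    obtain ⟨h1, h2⟩ := le_envelope_iff.1 (le_refl (envelope B L ℓ x))
    have hL : (0 : ℝ) ≤ L := Nat.cast_nonneg _
    refine le_envelope_iff.2 ⟨?_, fun q hq => ?_⟩
    · have := mul_nonneg hL (abs_nonneg (x - y))
      linarith
    · have h3 := mul_le_mul_of_nonneg_left (abs_sub_le x y (rat q.2 : ℝ)) hL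
      have := h2 q hq
      linarith
  have h1 := key x y
  have h2 := key y x
  rw [abs_sub_comm] at h2
  refine (abs_max_sub_max_le_max _ _ _ _).trans (max_le ?_ ?_)
  · simp only [sub_self, abs_zero]; positivity
  · exact abs_le.2 ⟨by linarith, by linarith⟩

theorem continuous_testFun (p : TestCode) : Continuous (testFun p) :=
  (LipschitzWith.of_dist_le_mul (K := (p.2.1 : NNReal)) fun x y => by
    simpa [Real.dist_eq] using abs_testFun_sub_le p x y).continuous

/-- The value of the envelope at a rational, on codes. -/
def envelopeRat (B L : ℕ) (ℓ : List (ℕ × ℕ)) (m : ℕ) : ℕ :=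
  ℓ.foldr (fun q y => ratMin (ratAdd q.1 (ratNsmul L
    (ratMax (ratAdd m (ratNeg q.2)) (ratNeg (ratAdd m (ratNeg q.2)))))) y) (ratMk B 0 0)

/-- The value of a test function at a rational, on codes. -/
def testFunRat (p : TestCode) (m : ℕ) : ℕ :=
  ratMax (ratNeg (ratMk p.1 0 0)) (envelopeRat p.1 p.2.1 p.2.2 m)

theorem rat_envelopeRat (B L : ℕ) (ℓ : List (ℕ × ℕ)) (m : ℕ) :
    ((rat (envelopeRat B L ℓ m) : ℚ) : ℝ) = envelope B L ℓ (rat m) := by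
  induction ℓ with
  | nil => simp [envelope, envelopeRat, rat_ratMk]
  | cons q ℓ ih =>
    have h : envelope B L (q :: ℓ) (rat m)
        = min ((rat q.1 : ℝ) + L * |(rat m : ℝ) - (rat q.2 : ℝ)|) (envelope B L ℓ (rat m)) := rfl
    rw [h, ← ih]
    change ((rat (ratMin _ (envelopeRat B L ℓ m)) : ℚ) : ℝ) = _
    rw [rat_ratMin, rat_ratAdd, rat_ratNsmul, rat_ratMax, rat_ratNeg, rat_ratAdd, rat_ratNeg,
      abs_eq_max_neg]
    push_cast
    simp only [sub_eq_add_neg]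

theorem rat_testFunRat (p : TestCode) (m : ℕ) :
    ((rat (testFunRat p m) : ℚ) : ℝ) = testFun p (rat m) := by
  rw [testFunRat, testFun, rat_ratMax, Rat.cast_max, rat_envelopeRat, rat_ratNeg, rat_ratMk]
  simp

theorem primrec_testFunRat : Primrec₂ testFunRat := by
  have hB : Primrec fun z : TestCode × ℕ => z.1.1 := Primrec.fst.comp Primrec.fst
  have hL : Primrec fun z : TestCode × ℕ => z.1.2.1 :=
    Primrec.fst.comp (Primrec.snd.comp Primrec.fst)
  have hl : Primrec fun z : TestCode × ℕ => z.1.2.2 :=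
    Primrec.snd.comp (Primrec.snd.comp Primrec.fst)
  have hB' := primrec_ratMk hB (Primrec.const 0) (Primrec.const 0)
  have hq1 : Primrec fun z : (TestCode × ℕ) × ((ℕ × ℕ) × ℕ) => z.2.1.1 :=
    Primrec.fst.comp (Primrec.fst.comp Primrec.snd)
  have hq2 : Primrec fun z : (TestCode × ℕ) × ((ℕ × ℕ) × ℕ) => z.2.1.2 :=
    Primrec.snd.comp (Primrec.fst.comp Primrec.snd)
  have hd : Primrec fun z : (TestCode × ℕ) × ((ℕ × ℕ) × ℕ) => ratAdd z.1.2 (ratNeg z.2.1.2) :=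
    primrec_ratAdd (Primrec.snd.comp Primrec.fst) (primrec_ratNeg hq2)
  have hstep : Primrec₂ fun (z : TestCode × ℕ) (y : (ℕ × ℕ) × ℕ) =>
      ratMin (ratAdd y.1.1 (ratNsmul z.1.2.1
        (ratMax (ratAdd z.2 (ratNeg y.1.2)) (ratNeg (ratAdd z.2 (ratNeg y.1.2)))))) y.2 :=
    primrec_ratMin (primrec_ratAdd hq1 (primrec_ratNsmul (hL.comp Primrec.fst)
      (primrec_ratMax hd (primrec_ratNeg hd)))) (Primrec.snd.comp Primrec.snd)
  exact primrec_ratMax (primrec_ratNeg hB') (Primrec.list_foldr hl hB' hstep)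

/-- Test functions are computable, uniformly in their codes: on oracle `ρ` and input `n`, evaluate
at the rational `ρ (n + 3 + L)`. -/
theorem exists_testFun_index :
    ∃ s : TestCode → Code, Computable s ∧ ∀ p, IndexesFunction (s p) (testFun p) := by
  have hF : Partrec₂ fun (p : TestCode) (z : List ℕ × ℕ) =>
      (((z.1[z.2 + 3 + p.2.1]?).map (testFunRat p) : Option ℕ) : Part ℕ) := by
    refine Computable.ofOption (Primrec.to_comp (Primrec.option_map ?_ ?_))
    · exact Primrec.list_getElem?.comp (Primrec.fst.comp Primrec.snd)
        (primrec_add (primrec_addConst (Primrec.snd.comp Primrec.snd) 3)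
          (Primrec.fst.comp (Primrec.snd.comp Primrec.fst)))
    · exact primrec_testFunRat.comp (Primrec.fst.comp Primrec.fst) Primrec.snd
  obtain ⟨s, hs, hsF⟩ := exists_functional_index hF
  refine ⟨s, hs, fun p x ρ hρ => ?_⟩
  have hmem : ∀ n, testFunRat p (ρ (n + 3 + p.2.1)) ∈ functional (s p) ρ n := by
    intro n
    obtain ⟨h1, h2⟩ := hsF p ρ n
    have hd := h2 (n + 3 + p.2.1 + 1) (by simp [initSeg])
    obtain ⟨y, hy⟩ := Part.dom_iff_mem.1 hd
    obtain ⟨k, hk⟩ := h1 y hy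
    simp only [initSeg, Part.mem_ofOption, Option.mem_def, List.getElem?_map, Option.map_map,
      Option.map_eq_some_iff, List.getElem?_eq_some_iff] at hk
    obtain ⟨a, ⟨_, ha⟩, rfl⟩ := hk
    simp only [List.getElem_range] at ha
    subst ha
    exact hy
  refine ⟨_, hmem, isCauchyName_of_dist_le fun n => ?_⟩
  rw [rat_testFunRat]
  refine (abs_testFun_sub_le p _ _).trans ?_
  have h1 := hρ.dist_le (n + 3 + p.2.1)
  -- the crude bound `L ≤ 2 ^ L` makes `L` additional terms of the name enough
  have h2 : (p.2.1 : ℝ) ≤ 2 ^ p.2.1 := by exact_mod_cast Nat.lt_two_pow_self.le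
  calc (p.2.1 : ℝ) * |(rat (ρ (n + 3 + p.2.1)) : ℝ) - x|
      ≤ 2 ^ p.2.1 * (2 * (2 : ℝ)⁻¹ ^ (n + 3 + p.2.1)) := by gcongr
    _ = (2 : ℝ)⁻¹ ^ (n + 2) := by
      rw [show n + 3 + p.2.1 = (n + 2) + 1 + p.2.1 by ring, pow_add, pow_succ, inv_pow _ p.2.1]
      field_simp

/-- Test functions approximate any bounded continuous function uniformly on compact intervals. -/
theorem exists_testFun_approx {f : ℝ → ℝ} (hf : Continuous f) {B : ℕ} (hB : ∀ x, |f x| ≤ B)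
    (a b : ℝ) {ε : ℝ} (hε : 0 < ε) :
    ∃ (L : ℕ) (ℓ : List (ℕ × ℕ)), ∀ x ∈ Set.Icc a b, |testFun (B, L, ℓ) x - f x| ≤ ε := by
  have huc : UniformContinuousOn f (Set.Icc (a - 1) (b + 1)) :=
    isCompact_Icc.uniformContinuousOn_of_continuous hf.continuousOn
  obtain ⟨η', hη', hosc'⟩ := Metric.uniformContinuousOn_iff.1 huc (ε / 4) (by positivity)
  obtain ⟨η, hη, hη1, hosc⟩ : ∃ η > 0, η ≤ 1 ∧ ∀ x ∈ Set.Icc a b, ∀ y, |x - y| < η →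
      |f x - f y| < ε / 4 := by
    refine ⟨min η' 1, lt_min hη' one_pos, min_le_right _ _, fun x hx y hxy => ?_⟩
    have h1 := abs_lt.1 (hxy.trans_le (min_le_right _ _))
    exact hosc' x ⟨by linarith [hx.1], by linarith [hx.2]⟩ y
      ⟨by linarith [hx.1], by linarith [hx.2]⟩ (hxy.trans_le (min_le_left _ _))
  -- for this slope, nodes at distance `η` or more from `x` do not lower the envelope at `x`
  obtain ⟨L, hL⟩ := exists_nat_gt ((2 * B + ε) / η)
  have hLη : 2 * B + ε ≤ L * η := ((div_lt_iff₀ hη).1 hL).le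
  have hLpos : (0 : ℝ) < L := lt_of_le_of_lt (by positivity) hL
  -- the mesh of the nodes: some node is so near to `x` that its cone is close to `f x` at `x`
  set δ := min η (ε / (4 * L)) with hδ
  have hδpos : 0 < δ := lt_min hη (by positivity)
  have hLδ : L * δ ≤ ε / 4 := by
    calc L * δ ≤ L * (ε / (4 * L)) := by gcongr; exact min_le_right _ _
      _ = ε / 4 := by field_simp
  obtain ⟨t, ht⟩ := (isCompact_Icc (a := a) (b := b)).elim_finite_subcover
    (fun r : ℚ => Metric.ball (r : ℝ) δ) (fun _ => Metric.isOpen_ball) (by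
      intro x _
      obtain ⟨r, hr1, hr2⟩ := exists_rat_btwn (show x < x + δ by linarith)
      refine Set.mem_iUnion.2 ⟨r, ?_⟩
      rw [Metric.mem_ball, Real.dist_eq, abs_lt]
      constructor <;> linarith)
  have hc : ∀ r : ℚ, ∃ c : ℚ, |(c : ℝ) - f r| < ε / 4 := by
    intro r
    obtain ⟨c, h1, h2⟩ := exists_rat_btwn (show f r < f r + ε / 4 by linarith)
    exact ⟨c, by rw [abs_lt]; constructor <;> linarith⟩
  choose c hc using hc
  choose code hcode using rat_surjective
  refine ⟨L, t.toList.map fun r => (code (c r), code r), fun x hx => ?_⟩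
  have hfx := abs_le.1 (hB x)
  have hle : f x - ε ≤ envelope B L (t.toList.map fun r => (code (c r), code r)) x := by
    refine le_envelope_iff.2 ⟨by linarith, fun q hq => ?_⟩
    obtain ⟨r, -, rfl⟩ := List.mem_map.1 hq
    simp only [hcode]
    have hcr := abs_lt.1 (hc r)
    rcases lt_or_ge |x - r| η with h | h
    · have h1 := abs_lt.1 (hosc x hx r h)
      have h2 : 0 ≤ L * |x - (r : ℝ)| := by positivity
      linarith
    · have h1 : L * η ≤ L * |x - (r : ℝ)| := by gcongr
      have h2 := abs_le.1 (hB r)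
      linarith
  have hge : envelope B L (t.toList.map fun r => (code (c r), code r)) x ≤ f x + ε := by
    obtain ⟨r, hrt, hr⟩ := Set.mem_iUnion₂.1 (ht hx)
    have hr' : |x - (r : ℝ)| < δ := hr
    have h1 := (le_envelope_iff.1 (le_refl (envelope B L
      (t.toList.map fun r => (code (c r), code r)) x))).2 _
        (List.mem_map.2 ⟨r, Finset.mem_toList.2 hrt, rfl⟩)
    simp only [hcode] at h1
    have h2 := abs_lt.1 (hosc x hx r (hr'.trans_le (min_le_left _ _)))
    have h3 : L * |x - (r : ℝ)| ≤ L * δ := by gcongr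
    have hcr := abs_lt.1 (hc r)
    linarith
  rw [abs_le, testFun]
  exact ⟨by linarith [le_max_right (-(B : ℝ)) (envelope B L
    (t.toList.map fun r => (code (c r), code r)) x)],
    by linarith [max_le (a := -(B : ℝ)) (by linarith : -(B : ℝ) ≤ f x + ε) hge]⟩

/-- The code of the test function `x ↦ max (-1) (min (|x| - N) 1)`. -/
def tailCode (N : ℕ) : TestCode := (1, 1, [(ratNeg (ratMk N 0 0), ratMk 0 0 0)])

/-- A continuous cut-off that vanishes near the origin: it is `0` on `[-(N - 1), N - 1]` and `1`
outside `(-(N + 1), N + 1)`. -/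
noncomputable def tail (N : ℕ) (x : ℝ) : ℝ := (1 + testFun (tailCode N) x) / 2

theorem testFun_tailCode (N : ℕ) (x : ℝ) :
    testFun (tailCode N) x = max (-1) (min (|x| - N) 1) := by
  simp [testFun, envelope, tailCode, rat_ratNeg, rat_ratMk, sub_eq_add_neg, add_comm]

theorem tail_nonneg (N : ℕ) (x : ℝ) : 0 ≤ tail N x := by
  have := (abs_le.1 (abs_testFun_le (tailCode N) x)).1
  simp only [tailCode, Nat.cast_one] at this
  unfold tail tailCode
  linarith

theorem tail_le_one (N : ℕ) (x : ℝ) : tail N x ≤ 1 := by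
  have := (abs_le.1 (abs_testFun_le (tailCode N) x)).2
  simp only [tailCode, Nat.cast_one] at this
  unfold tail tailCode
  linarith

theorem tail_eq_zero {N : ℕ} {x : ℝ} (h : |x| ≤ (N : ℝ) - 1) : tail N x = 0 := by
  rw [tail, testFun_tailCode, min_eq_left (by linarith), max_eq_left (by linarith)]
  norm_num

theorem tail_eq_one {N : ℕ} {x : ℝ} (h : (N : ℝ) + 1 ≤ |x|) : tail N x = 1 := by
  rw [tail, testFun_tailCode, min_eq_right (by linarith), max_eq_right (by linarith)]
  norm_num

theorem continuous_tail (N : ℕ) : Continuous (tail N) :=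
  (continuous_const.add (continuous_testFun _)).div_const 2

/-- The code of the test function with constant value `1`. -/
def oneCode : TestCode := (1, 0, [])

theorem testFun_oneCode (x : ℝ) : testFun oneCode x = 1 := by
  simp [testFun, envelope, oneCode]

theorem primrec_tailCode : Primrec tailCode := by
  refine Primrec.pair (Primrec.const 1) (Primrec.pair (Primrec.const 1) ?_)
  exact Primrec.list_cons.comp (Primrec.pair (primrec_ratNeg (primrec_ratMk Primrec.id
    (Primrec.const 0) (Primrec.const 0))) (Primrec.const _)) (Primrec.const [])

/-! ### Computable functions are continuous, and their compact-open names are computable -/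

/-- Stage `t` of the computation of `functional c ρ n`. -/
def functionalStage (c : Code) (ρ : ℕ → ℕ) (n t : ℕ) : Option ℕ :=
  c.evaln t.unpair.1 (Nat.pair (Encodable.encode (initSeg ρ t.unpair.2)) n)

theorem mem_functional_iff {c : Code} {ρ : ℕ → ℕ} {n y : ℕ} :
    y ∈ functional c ρ n ↔ ∃ t, functionalStage c ρ n t = some y ∧
      ∀ t' < t, functionalStage c ρ n t' = none := by
  change y ∈ Nat.rfindOpt (functionalStage c ρ n) ↔ _
  rw [Nat.rfindOpt, Part.mem_bind_iff]
  constructor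
  · rintro ⟨t, ht, h3⟩
    refine ⟨t, Part.mem_ofOption.1 h3, fun t' ht' => ?_⟩
    simpa using (Nat.mem_rfind.1 ht).2 ht'
  · rintro ⟨t, h1, h2⟩
    refine ⟨t, Nat.mem_rfind.2 ⟨?_, fun {m} hm => ?_⟩, Part.mem_ofOption.2 h1⟩
    · simp [h1]
    · simp [h2 m hm]

theorem functionalStage_congr {c : Code} {ρ ρ' : ℕ → ℕ} {k : ℕ} (h : ∀ i ≤ k, ρ i = ρ' i)
    (n : ℕ) {t : ℕ} (ht : t ≤ k) : functionalStage c ρ n t = functionalStage c ρ' n t := by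
  unfold functionalStage
  rw [initSeg_congr fun i hi => h i ((hi.le.trans t.unpair_right_le).trans ht)]

/-- The data of a local certificate: `(σ, k, n, t, y)`, see `IsLocalCert`. -/
abbrev LocalCert : Type := List ℕ × ℕ × ℕ × ℕ × ℕ

/-- `w = (σ, k, n, t, y)` certifies that the functional with index `e` has the output `y` on input
`n` for every oracle that begins with `σ 0, …, σ k`, and that this segment can be continued to a
Cauchy name.  The bound `t ≤ k` ensures that the computation does not read beyond the segment. -/
def IsLocalCert (e : Code) (w : LocalCert) : Prop :=
  (∀ i < w.2.1, rat (w.1.getD i 0) < rat (ratAdd (w.1.getD (i + 1) 0) (ratHalfPow i)) ∧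
    rat (w.1.getD (i + 1) 0) < rat (ratAdd (w.1.getD i 0) (ratHalfPow i))) ∧
  w.2.2.2.1 ≤ w.2.1 ∧
  functionalStage e (fun i => w.1.getD i 0) w.2.2.1 w.2.2.2.1 = some w.2.2.2.2 ∧
  ∀ t' < w.2.2.2.1, functionalStage e (fun i => w.1.getD i 0) w.2.2.1 t' = none

/-- The center of the interval of reals with a Cauchy name that begins with the certified segment;
its radius is `2⁻¹ ^ k`. -/
noncomputable def certCenter (w : LocalCert) : ℝ := rat (w.1.getD w.2.1 0)

theorem exists_isCauchyName_fast (x : ℝ) {r : ℝ} (hr : 0 < r) :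
    ∃ ρ : ℕ → ℕ, ∀ n, |(rat (ρ n) : ℝ) - x| ≤ (2 : ℝ)⁻¹ ^ (n + 2) ∧ |(rat (ρ n) : ℝ) - x| < r := by
  have : ∀ n : ℕ, ∃ m : ℕ, |(rat m : ℝ) - x| ≤ (2 : ℝ)⁻¹ ^ (n + 2) ∧ |(rat m : ℝ) - x| < r := by
    intro n
    have hpos : 0 < min ((2 : ℝ)⁻¹ ^ (n + 2)) r := lt_min (by positivity) hr
    obtain ⟨q, h1, h2⟩ := exists_rat_btwn
      (show x < x + min ((2 : ℝ)⁻¹ ^ (n + 2)) r by linarith)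
    obtain ⟨m, rfl⟩ := rat_surjective q
    have h3 : |(rat m : ℝ) - x| < min ((2 : ℝ)⁻¹ ^ (n + 2)) r := by
      rw [abs_lt]; constructor <;> linarith
    exact ⟨m, (h3.trans_le (min_le_left _ _)).le, h3.trans_le (min_le_right _ _)⟩
  choose ρ hρ using this
  exact ⟨ρ, hρ⟩

theorem abs_rat_sub_lt_iff (m n : ℕ) (i : ℕ) :
    |rat m - rat n| < (2 : ℚ)⁻¹ ^ i ↔
      rat m < rat (ratAdd n (ratHalfPow i)) ∧ rat n < rat (ratAdd m (ratHalfPow i)) := by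
  rw [rat_ratAdd, rat_ratAdd, rat_ratHalfPow, abs_lt]
  constructor <;> rintro ⟨h1, h2⟩ <;> constructor <;> linarith

/-- A finite segment whose last entry is close enough to `x` can be continued to a Cauchy name
of `x`. -/
theorem exists_isCauchyName_extend {σ : ℕ → ℕ} {k : ℕ}
    (hσ : ∀ i < k, |rat (σ i) - rat (σ (i + 1))| < (2 : ℚ)⁻¹ ^ i) {x : ℝ}
    (hx : |x - rat (σ k)| < (2 : ℝ)⁻¹ ^ k) :
    ∃ ρ, IsCauchyName ρ x ∧ ∀ i ≤ k, ρ i = σ i := by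
  obtain ⟨g, hg⟩ := exists_isCauchyName_fast x (sub_pos.2 hx)
  have hgc := isCauchyName_of_dist_le fun n => (hg n).1
  have hρ1 : ∀ i ≤ k, (if i ≤ k then σ i else g i) = σ i := fun i hi => if_pos hi
  have hρ2 : ∀ i, k < i → (if i ≤ k then σ i else g i) = g i := fun i hi => if_neg (not_le.2 hi)
  refine ⟨fun i => if i ≤ k then σ i else g i, ⟨fun i => ?_, ?_⟩, hρ1⟩
  · beta_reduce
    rcases lt_trichotomy i k with hi | rfl | hi
    · rw [hρ1 i hi.le, hρ1 (i + 1) hi]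
      exact hσ i hi
    · rw [hρ1 i le_rfl, hρ2 (i + 1) (Nat.lt_succ_self _)]
      have h5 := (hg (i + 1)).2
      have h6 := abs_sub_le (rat (σ i) : ℝ) x (rat (g (i + 1)))
      rw [abs_sub_comm _ x, abs_sub_comm x (rat (g (i + 1)) : ℝ)] at h6
      rw [← Rat.cast_lt (K := ℝ)]
      push_cast
      linarith
    · rw [hρ2 i hi, hρ2 (i + 1) (hi.trans (Nat.lt_succ_self _))]
      exact hgc.1 i
  · refine hgc.2.congr' ?_
    filter_upwards [eventually_gt_atTop k] with i hi
    rw [hρ2 i hi]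

/-- A certified output approximates `f` at every point of the certified interval, because each of
these points has a Cauchy name on which the functional runs the certified computation. -/
theorem IsLocalCert.abs_sub_le {e : Code} {f : ℝ → ℝ} (hf : IndexesFunction e f) {w : LocalCert}
    (hw : IsLocalCert e w) {x : ℝ} (hx : |x - certCenter w| < (2 : ℝ)⁻¹ ^ w.2.1) :
    |(rat w.2.2.2.2 : ℝ) - f x| ≤ 2 * (2 : ℝ)⁻¹ ^ w.2.2.1 := by
  obtain ⟨h1, h2, h3, h4⟩ := hw
  obtain ⟨ρ, hname, hρ⟩ := exists_isCauchyName_extend (σ := fun i => w.1.getD i 0)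
    (fun i hi => (abs_rat_sub_lt_iff _ _ _).2 (h1 i hi)) hx
  obtain ⟨τ, hτ, hτn⟩ := hf x ρ hname
  have hy : w.2.2.2.2 ∈ functional e ρ w.2.2.1 := by
    refine mem_functional_iff.2 ⟨w.2.2.2.1, ?_, fun t' ht' => ?_⟩
    · rw [functionalStage_congr hρ _ h2, h3]
    · rw [functionalStage_congr hρ _ (ht'.le.trans h2), h4 t' ht']
  rw [Part.mem_unique hy (hτ _)]
  exact hτn.dist_le _

/-- Local certificates exist around every point: the Cauchy name used converges fast enough for the
point to lie inside the interval belonging to each initial segment. -/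
theorem exists_isLocalCert {e : Code} {f : ℝ → ℝ} (hf : IndexesFunction e f) (x : ℝ) (n : ℕ) :
    ∃ w : LocalCert, w.2.2.1 = n ∧ IsLocalCert e w ∧
      |x - certCenter w| < (2 : ℝ)⁻¹ ^ w.2.1 := by
  obtain ⟨ρ, hρ⟩ := exists_isCauchyName_fast x one_pos
  have hname := isCauchyName_of_dist_le fun n => (hρ n).1
  obtain ⟨τ, hτ, -⟩ := hf x ρ hname
  obtain ⟨t, h1, h2⟩ := mem_functional_iff.1 (hτ n)
  have hσ : ∀ i ≤ t, (initSeg ρ (t + 1)).getD i 0 = ρ i := by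
    intro i hi
    simp [initSeg, List.getD_eq_getElem?_getD, List.getElem?_range (Nat.lt_succ_of_le hi)]
  refine ⟨(initSeg ρ (t + 1), t, n, t, τ n), rfl, ⟨fun i hi => ?_, le_rfl, ?_, fun t' ht' => ?_⟩, ?_⟩
  · simp only at hi ⊢
    rw [hσ i hi.le, hσ (i + 1) hi]
    exact (abs_rat_sub_lt_iff _ _ _).1 (hname.1 i)
  · exact (functionalStage_congr hσ n le_rfl).trans h1
  · exact (functionalStage_congr hσ n ht'.le).trans (h2 t' ht')
  · simp only [certCenter]
    rw [hσ t le_rfl, abs_sub_comm]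
    refine (hρ t).1.trans_lt ?_
    exact pow_lt_pow_right_of_lt_one₀ (by norm_num) (by norm_num) (by omega)

theorem exists_four_mul_half_pow_lt {ε : ℝ} (hε : 0 < ε) : ∃ n : ℕ, 4 * (2 : ℝ)⁻¹ ^ n < ε := by
  obtain ⟨n, hn⟩ := exists_pow_lt_of_lt_one (show 0 < ε / 4 by positivity)
    (show (2 : ℝ)⁻¹ < 1 by norm_num)
  exact ⟨n, by linarith⟩

theorem IndexesFunction.continuous {e : Code} {f : ℝ → ℝ} (hf : IndexesFunction e f) :
    Continuous f := by
  refine Metric.continuous_iff.2 fun x ε hε => ?_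
  obtain ⟨n, hn⟩ := exists_four_mul_half_pow_lt hε
  obtain ⟨w, rfl, hw, hx⟩ := exists_isLocalCert hf x n
  refine ⟨(2 : ℝ)⁻¹ ^ w.2.1 - |x - certCenter w|, sub_pos.2 hx, fun x' hx' => ?_⟩
  rw [Real.dist_eq] at hx' ⊢
  have h1 := hw.abs_sub_le hf hx
  have h2 := hw.abs_sub_le hf (x := x') (by
    linarith [abs_sub_le x' x (certCenter w)])
  have h3 := abs_sub_le (f x') (rat w.2.2.2.2 : ℝ) (f x)
  rw [abs_sub_comm (f x') (rat w.2.2.2.2 : ℝ)] at h3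
  linarith

/-- The data of a finite cover: `(D, N, W)`, see `IsCover`. -/
abbrev CoverCert : Type := ℕ × ℕ × List LocalCert

/-- The code of the grid point `a + i / (D + 1)`, where `a` is a code of a rational. -/
def gridPoint (a D i : ℕ) : ℕ := ratAdd a (ratMk i 0 D)

theorem rat_gridPoint (a D i : ℕ) : rat (gridPoint a D i) = rat a + i / ((D : ℚ) + 1) := by
  rw [gridPoint, rat_ratAdd, rat_ratMk]; simp

/-- `v` certifies that `f` maps the grid cell from `l` to `r` into the interval `J` (all given by
codes): the cell lies inside the certified interval, and the approximate value with its error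
bound `2 * 2⁻¹ ^ n` lies inside `J`. -/
def IsCellCert (e : Code) (J l r : ℕ) (v : LocalCert) : Prop :=
  IsLocalCert e v ∧
  rat (v.1.getD v.2.1 0) < rat (ratAdd l (ratHalfPow v.2.1)) ∧
  rat r < rat (ratAdd (v.1.getD v.2.1 0) (ratHalfPow v.2.1)) ∧
  rat (ratAdd J.unpair.1 (ratNsmul 2 (ratHalfPow v.2.2.1))) < rat v.2.2.2.2 ∧
  rat (ratAdd v.2.2.2.2 (ratNsmul 2 (ratHalfPow v.2.2.1))) < rat J.unpair.2

/-- `w = (D, N, W)` certifies that the function with index `e` maps the compact interval coded by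
`m` into the open interval coded by `m`: the `N` grid cells of length `1 / (D + 1)` that start at
the left end point cover the compact interval, and `W` certifies each of them. -/
def IsCover (e : Code) (m : ℕ) (w : CoverCert) : Prop :=
  ¬ rat m.unpair.1.unpair.2 < rat m.unpair.1.unpair.1 ∧
  rat m.unpair.1.unpair.2 < rat (gridPoint m.unpair.1.unpair.1 w.1 w.2.1) ∧
  ∀ i < w.2.1, IsCellCert e m.unpair.2 (gridPoint m.unpair.1.unpair.1 w.1 i)
    (gridPoint m.unpair.1.unpair.1 w.1 (i + 1)) (w.2.2.getD i ([], 0, 0, 0, 0))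

/-- Every point between the first and the last grid point lies in a grid cell. -/
theorem exists_mem_gridCell {a D N : ℕ} {x : ℝ} (h1 : (rat a : ℝ) ≤ x)
    (h2 : x < rat (gridPoint a D N)) :
    ∃ i < N, x ∈ Set.Icc (rat (gridPoint a D i) : ℝ) (rat (gridPoint a D (i + 1)) : ℝ) := by
  simp only [rat_gridPoint] at h2 ⊢
  push_cast at h2 ⊢
  have hD : (0 : ℝ) < (D : ℝ) + 1 := by positivity
  have h0 : 0 ≤ (x - rat a) * ((D : ℝ) + 1) := mul_nonneg (by linarith) hD.le
  have hfl := Nat.floor_le h0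
  have hfl' := Nat.lt_floor_add_one ((x - rat a) * ((D : ℝ) + 1))
  refine ⟨⌊(x - rat a) * ((D : ℝ) + 1)⌋₊, ?_, ?_, ?_⟩
  · rw [Nat.floor_lt h0, ← lt_div_iff₀ hD]
    linarith
  · have := (div_le_iff₀ hD).2 hfl
    linarith
  · have := (lt_div_iff₀ hD).2 hfl'
    linarith

/-- Finite covers are sound. -/
theorem IsCover.memSubbasic {e : Code} {f : ℝ → ℝ} (hf : IndexesFunction e f) {m : ℕ}
    {w : CoverCert} (hw : IsCover e m w) : MemSubbasic f m := by
  obtain ⟨h1, h2, h3⟩ := hw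
  refine ⟨not_lt.1 h1, ?_⟩
  rintro _ ⟨x, hx, rfl⟩
  obtain ⟨i, hi, hxi⟩ := exists_mem_gridCell (D := w.1) (N := w.2.1) hx.1
    (hx.2.trans_lt (by exact_mod_cast h2))
  obtain ⟨hl, h4, h5, h6, h7⟩ := h3 i hi
  set v := w.2.2.getD i ([], 0, 0, 0, 0)
  simp only [rat_ratAdd, rat_ratHalfPow, rat_ratNsmul] at h4 h5 h6 h7
  rw [← Rat.cast_lt (K := ℝ)] at h4 h5 h6 h7
  push_cast at h4 h5 h6 h7
  have hc : |x - certCenter v| < (2 : ℝ)⁻¹ ^ v.2.1 := by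
    unfold certCenter
    rw [abs_lt]
    constructor <;> linarith [hxi.1, hxi.2]
  have := abs_le.1 (hl.abs_sub_le hf hc)
  exact ⟨by linarith, by linarith⟩

/-- Finite covers exist: by the Lebesgue number lemma, each cell of a fine enough grid lies inside
one certified interval. -/
theorem exists_isCover {e : Code} {f : ℝ → ℝ} (hf : IndexesFunction e f) {m : ℕ}
    (hm : MemSubbasic f m) : ∃ w, IsCover e m w := by
  obtain ⟨hab, hsub⟩ := hm
  set a := m.unpair.1.unpair.1
  set b := m.unpair.1.unpair.2
  have hab' : (rat a : ℝ) ≤ rat b := by exact_mod_cast hab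
  -- every point of the compact interval has a certified neighbourhood
  have hloc : ∀ x : Set.Icc (rat a : ℝ) (rat b : ℝ), ∃ w : LocalCert, IsLocalCert e w ∧
      |x.1 - certCenter w| < (2 : ℝ)⁻¹ ^ w.2.1 ∧
      rat (ratAdd m.unpair.2.unpair.1 (ratNsmul 2 (ratHalfPow w.2.2.1))) < rat w.2.2.2.2 ∧
      rat (ratAdd w.2.2.2.2 (ratNsmul 2 (ratHalfPow w.2.2.1))) < rat m.unpair.2.unpair.2 := by
    rintro ⟨x, hx⟩
    have hfx := hsub ⟨x, hx, rfl⟩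
    obtain ⟨n, hn⟩ := exists_four_mul_half_pow_lt (lt_min (sub_pos.2 hfx.1) (sub_pos.2 hfx.2))
    obtain ⟨w, rfl, hw, hxw⟩ := exists_isLocalCert hf x n
    have h1 := abs_le.1 (hw.abs_sub_le hf hxw)
    have h2 := hn.trans_le (min_le_left _ _)
    have h3 := hn.trans_le (min_le_right _ _)
    refine ⟨w, hw, hxw, ?_, ?_⟩ <;> rw [← Rat.cast_lt (K := ℝ)] <;>
      simp only [rat_ratAdd, rat_ratHalfPow, rat_ratNsmul] <;> push_cast <;> linarith
  choose W hW1 hW2 hW3 hW4 using hloc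
  obtain ⟨δ, hδ, hleb⟩ := lebesgue_number_lemma_of_metric
    (s := Set.Icc (rat a : ℝ) (rat b : ℝ))
    (c := fun x => Metric.ball (certCenter (W x)) ((2 : ℝ)⁻¹ ^ (W x).2.1)) isCompact_Icc
    (fun _ => Metric.isOpen_ball) (fun x hx => Set.mem_iUnion.2 ⟨⟨x, hx⟩, hW2 ⟨x, hx⟩⟩)
  obtain ⟨D, hD⟩ := exists_nat_one_div_lt hδ
  have hDpos : (0 : ℝ) < (D : ℝ) + 1 := by positivity
  have h0 : 0 ≤ ((rat b : ℝ) - rat a) * ((D : ℝ) + 1) := mul_nonneg (by linarith) hDpos.le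
  set N := ⌊((rat b : ℝ) - rat a) * ((D : ℝ) + 1)⌋₊ + 1 with hN
  -- `N` is chosen so that all left end points of cells lie in the compact interval
  have hcell : ∀ i : ℕ, ∃ v : LocalCert, i < N →
      IsCellCert e m.unpair.2 (gridPoint a D i) (gridPoint a D (i + 1)) v := by
    intro i
    by_cases hi : i < N
    swap
    · exact ⟨([], 0, 0, 0, 0), fun h => absurd h hi⟩
    have hi' : (i : ℝ) ≤ ((rat b : ℝ) - rat a) * ((D : ℝ) + 1) :=
      (Nat.le_floor_iff h0).1 (Nat.lt_succ_iff.1 hi)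
    have hi'' := (div_le_iff₀ hDpos).2 hi'
    have hi0 : 0 ≤ (i : ℝ) / ((D : ℝ) + 1) := by positivity
    obtain ⟨x, hx⟩ := hleb ((rat a : ℝ) + i / ((D : ℝ) + 1)) ⟨by linarith, by linarith⟩
    have hl := hx (Metric.mem_ball_self hδ)
    have hr : (rat a : ℝ) + i / ((D : ℝ) + 1) + 1 / ((D : ℝ) + 1) ∈
        Metric.ball ((rat a : ℝ) + i / ((D : ℝ) + 1)) δ := by
      rw [Metric.mem_ball, Real.dist_eq, add_sub_cancel_left, abs_of_pos (by positivity)]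
      exact hD
    have hr := hx hr
    rw [Metric.mem_ball, Real.dist_eq, abs_lt] at hl hr
    unfold certCenter at hl hr
    refine ⟨W x, fun _ => ⟨hW1 x, ?_, ?_, hW3 x, hW4 x⟩⟩ <;> rw [← Rat.cast_lt (K := ℝ)] <;>
      simp only [rat_ratAdd, rat_ratHalfPow, rat_gridPoint] <;> push_cast
    · linarith [hl.1]
    · rw [add_div]; linarith [hr.2]
  choose V hV using hcell
  refine ⟨(D, N, (List.range N).map V), not_lt.2 hab, ?_, fun i hi => ?_⟩
  · rw [← Rat.cast_lt (K := ℝ), rat_gridPoint]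
    have := (lt_div_iff₀ hDpos).2 (Nat.lt_floor_add_one (((rat b : ℝ) - rat a) * ((D : ℝ) + 1)))
    simp only [hN]
    push_cast
    linarith
  · have : ((List.range N).map V).getD i ([], 0, 0, 0, 0) = V i := by
      simp [List.getD_eq_getElem?_getD, List.getElem?_range (show i < N from hi)]
    simp only [this]
    exact hV i hi

section Primrec

variable {α : Type*} [Primcodable α]

theorem primrec_initSeg {ρ : α → ℕ → ℕ} (hρ : Primrec₂ ρ) {k : α → ℕ} (hk : Primrec k) :
    Primrec fun a => initSeg (ρ a) (k a) :=
  Primrec.list_map (Primrec.list_range.comp hk) hρ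

theorem primrec_functionalStage {e : α → Code} {ρ : α → ℕ → ℕ} {n t : α → ℕ} (he : Primrec e)
    (hρ : Primrec₂ ρ) (hn : Primrec n) (ht : Primrec t) :
    Primrec fun a => functionalStage (e a) (ρ a) (n a) (t a) :=
  Nat.Partrec.Code.primrec_evaln.comp (Primrec.pair (Primrec.pair (primrec_unpairFst ht) he)
    (Primrec₂.natPair.comp (Primrec.encode.comp (primrec_initSeg hρ (primrec_unpairSnd ht))) hn))

theorem primrec_gridPoint {a D i : α → ℕ} (ha : Primrec a) (hD : Primrec D) (hi : Primrec i) :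
    Primrec fun z => gridPoint (a z) (D z) (i z) :=
  primrec_ratAdd ha (primrec_ratMk hi (Primrec.const 0) hD)

theorem primrecPred_isLocalCert {e : α → Code} {w : α → LocalCert} (he : Primrec e)
    (hw : Primrec w) : PrimrecPred fun a => IsLocalCert (e a) (w a) := by
  have hσ := Primrec.fst.comp hw
  have hk := Primrec.fst.comp (Primrec.snd.comp hw)
  have hn := Primrec.fst.comp (Primrec.snd.comp (Primrec.snd.comp hw))
  have ht := Primrec.fst.comp (Primrec.snd.comp (Primrec.snd.comp (Primrec.snd.comp hw)))
  have hy := Primrec.snd.comp (Primrec.snd.comp (Primrec.snd.comp (Primrec.snd.comp hw)))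
  have hget : Primrec₂ fun (a : α) (i : ℕ) => (w a).1.getD i 0 :=
    (Primrec.list_getD 0).comp (hσ.comp Primrec.fst) Primrec.snd
  have hget' : Primrec fun z : α × ℕ => (w z.1).1.getD (z.2 + 1) 0 :=
    (Primrec.list_getD 0).comp (hσ.comp Primrec.fst) (primrec_addConst Primrec.snd 1)
  have hpow : Primrec fun z : α × ℕ => ratHalfPow z.2 := primrec_ratHalfPow Primrec.snd
  refine (primrecPred_forall_lt (PrimrecPred.and
    (primrecPred_ratLt hget (primrec_ratAdd hget' hpow))
    (primrecPred_ratLt hget' (primrec_ratAdd hget hpow))) hk).and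
    ((Primrec.nat_le.comp ht hk).and ((Primrec.eq.comp (primrec_functionalStage he hget hn ht)
      (Primrec.option_some.comp hy)).and (primrecPred_forall_lt ?_ ht)))
  refine Primrec.eq.comp ?_ (Primrec.const none)
  exact primrec_functionalStage (he.comp Primrec.fst)
    (hget.comp (Primrec.fst.comp Primrec.fst) Primrec.snd) (hn.comp Primrec.fst) Primrec.snd

theorem primrecPred_isCellCert {e : α → Code} {J l r : α → ℕ} {v : α → LocalCert} (he : Primrec e)
    (hJ : Primrec J) (hl : Primrec l) (hr : Primrec r) (hv : Primrec v) :
    PrimrecPred fun a => IsCellCert (e a) (J a) (l a) (r a) (v a) := by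
  have hk := Primrec.fst.comp (Primrec.snd.comp hv)
  have hn := Primrec.fst.comp (Primrec.snd.comp (Primrec.snd.comp hv))
  have hy := Primrec.snd.comp (Primrec.snd.comp (Primrec.snd.comp (Primrec.snd.comp hv)))
  have hp : Primrec fun a => (v a).1.getD (v a).2.1 0 :=
    (Primrec.list_getD 0).comp (Primrec.fst.comp hv) hk
  have herr : Primrec fun a => ratNsmul 2 (ratHalfPow (v a).2.2.1) :=
    primrec_ratNsmul (Primrec.const 2) (primrec_ratHalfPow hn)
  exact (primrecPred_isLocalCert he hv).and
    ((primrecPred_ratLt hp (primrec_ratAdd hl (primrec_ratHalfPow hk))).and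
    ((primrecPred_ratLt hr (primrec_ratAdd hp (primrec_ratHalfPow hk))).and
    ((primrecPred_ratLt (primrec_ratAdd (primrec_unpairFst hJ) herr) hy).and
    (primrecPred_ratLt (primrec_ratAdd hy herr) (primrec_unpairSnd hJ)))))

theorem primrecPred_isCover {e : α → Code} {m : α → ℕ} {w : α → CoverCert} (he : Primrec e)
    (hm : Primrec m) (hw : Primrec w) : PrimrecPred fun a => IsCover (e a) (m a) (w a) := by
  have ha := primrec_unpairFst (primrec_unpairFst hm)
  have hb := primrec_unpairSnd (primrec_unpairFst hm)
  have hD := Primrec.fst.comp hw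
  have hN := Primrec.fst.comp (Primrec.snd.comp hw)
  have hW := Primrec.snd.comp (Primrec.snd.comp hw)
  refine (primrecPred_ratLt hb ha).not.and
    ((primrecPred_ratLt hb (primrec_gridPoint ha hD hN)).and (primrecPred_forall_lt ?_ hN))
  exact primrecPred_isCellCert (he.comp Primrec.fst) ((primrec_unpairSnd hm).comp Primrec.fst)
    (primrec_gridPoint (ha.comp Primrec.fst) (hD.comp Primrec.fst) Primrec.snd)
    (primrec_gridPoint (ha.comp Primrec.fst) (hD.comp Primrec.fst) (primrec_addConst Primrec.snd 1))
    ((Primrec.list_getD _).comp (hW.comp Primrec.fst) Primrec.snd)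

end Primrec

/-- A code of the pair of `[0, 0]` and `(-(B + 1), B + 1)`. -/
def trivialSubbasic (B : ℕ) : ℕ :=
  Nat.pair (Nat.pair (ratMk 0 0 0) (ratMk 0 0 0)) (Nat.pair (ratMk 0 (B + 1) 0) (ratMk (B + 1) 0 0))

theorem memSubbasic_trivialSubbasic {f : ℝ → ℝ} {B : ℕ} (hB : ∀ x, |f x| ≤ B) :
    MemSubbasic f (trivialSubbasic B) := by
  refine ⟨by simp [trivialSubbasic], ?_⟩
  rintro _ ⟨x, -, rfl⟩
  have := abs_le.1 (hB x)
  simp only [openInterval, trivialSubbasic, Nat.unpair_pair, rat_ratMk]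
  push_cast
  exact ⟨by linarith, by linarith⟩

open Classical in
/-- A compact-open name of a function bounded by `B` with index `e`: it lists the codes that have
a certificate, and falls back on a code that is always allowed. -/
noncomputable def compactOpenName (p : Code × ℕ) (z : ℕ) : ℕ :=
  if IsCover p.1 z.unpair.1 ((Encodable.decode z.unpair.2 : Option CoverCert).getD (0, 0, []))
  then z.unpair.1 else trivialSubbasic p.2

theorem isCompactOpenName_compactOpenName {e : Code} {f : ℝ → ℝ} (hf : IndexesFunction e f) {B : ℕ}
    (hB : ∀ x, |f x| ≤ B) : IsCompactOpenName (compactOpenName (e, B)) f := by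
  ext m
  constructor
  · rintro ⟨z, rfl⟩
    unfold compactOpenName
    split_ifs with h
    · exact h.memSubbasic hf
    · exact memSubbasic_trivialSubbasic hB
  · intro hm
    obtain ⟨w, hw⟩ := exists_isCover hf hm
    refine ⟨Nat.pair m (Encodable.encode w), ?_⟩
    rw [compactOpenName, Nat.unpair_pair, Encodable.encodek]
    exact if_pos hw

theorem primrec_compactOpenName : Primrec₂ compactOpenName := by
  have he : Primrec fun q : (Code × ℕ) × ℕ => q.1.1 := Primrec.fst.comp Primrec.fst
  have hB : Primrec fun q : (Code × ℕ) × ℕ => q.1.2 + 1 :=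
    primrec_addConst (Primrec.snd.comp Primrec.fst) 1
  have hz : Primrec fun q : (Code × ℕ) × ℕ => q.2 := Primrec.snd
  classical
  refine Primrec.ite (primrecPred_isCover he (primrec_unpairFst hz)
    (Primrec.option_getD.comp (Primrec.decode.comp (primrec_unpairSnd hz)) (Primrec.const _)))
    (primrec_unpairFst hz) ?_
  exact Primrec₂.natPair.comp (Primrec.const _) (Primrec₂.natPair.comp
    (primrec_ratMk (Primrec.const 0) hB (Primrec.const 0))
    (primrec_ratMk hB (Primrec.const 0) (Primrec.const 0)))

theorem tendsto_integral_of_tendsto {μs : ℕ → FiniteMeasure ℝ} {μ : FiniteMeasure ℝ}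
    (h : Tendsto μs atTop (𝓝 μ)) {f : ℝ → ℝ} (hf : Continuous f) {B : ℝ} (hB : ∀ x, |f x| ≤ B) :
    Tendsto (fun n => ∫ x, f x ∂(μs n : Measure ℝ)) atTop (𝓝 (∫ x, f x ∂(μ : Measure ℝ))) :=
  FiniteMeasure.tendsto_iff_forall_integral_tendsto.1 h
    (BoundedContinuousFunction.ofNormedAddCommGroup f hf B hB)

theorem UniformlyEffectivelyWeaklyConverges.effectivelyWeaklyConverges
    {μs : ℕ → FiniteMeasure ℝ} {μ : FiniteMeasure ℝ}
    (h : UniformlyEffectivelyWeaklyConverges μs μ) : EffectivelyWeaklyConverges μs μ := by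
  obtain ⟨hlim, c, hc⟩ := h
  refine ⟨fun f e B hf hB => tendsto_integral_of_tendsto hlim hf.continuous hB, ?_⟩
  have hQ : Partrec₂ fun (p : Code × ℕ) (k : ℕ) =>
      functional c (compactOpenName p) (Nat.pair p.2 k) := by
    refine Partrec.rfindOpt (Primrec.to_comp ?_)
    refine primrec_functionalStage (Primrec.const c)
      (primrec_compactOpenName.comp (Primrec.fst.comp (Primrec.fst.comp Primrec.fst)) Primrec.snd)
      (Primrec₂.natPair.comp (Primrec.snd.comp (Primrec.fst.comp Primrec.fst))
        (Primrec.snd.comp Primrec.fst)) Primrec.snd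
  obtain ⟨s, hs, hsQ⟩ := exists_computable_index hQ
  refine ⟨fun p => Part.some (s p), hs.partrec, fun f e B hf hB => ?_⟩
  obtain ⟨g, hg, hmod⟩ := hc f _ B hf.continuous (isCompactOpenName_compactOpenName hf hB) hB
  exact ⟨s (e, B), Part.mem_some _, g, fun k => by rw [hsQ]; exact hg k, hmod⟩

/-! ### Effective tightness -/

theorem IsModulus.tendsto {g : ℕ → ℕ} {a : ℕ → ℝ} {l : ℝ} (h : IsModulus g a l) :
    Tendsto a atTop (𝓝 l) := by
  refine Metric.tendsto_atTop.2 fun ε hε => ?_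
  obtain ⟨k, hk⟩ := exists_pow_lt_of_lt_one hε (show (2 : ℝ)⁻¹ < 1 by norm_num)
  exact ⟨g k, fun n hn => (h k n hn).trans hk⟩

/-- Effective weak convergence provides moduli for the test functions, computable from their
codes. -/
theorem EffectivelyWeaklyConverges.exists_testFun_modulus {μs : ℕ → FiniteMeasure ℝ}
    {μ : FiniteMeasure ℝ} (h : EffectivelyWeaklyConverges μs μ) :
    ∃ m : TestCode → ℕ → ℕ, Computable₂ m ∧ ∀ p, IsModulus (m p)
      (fun n => ∫ x, testFun p x ∂(μs n : Measure ℝ)) (∫ x, testFun p x ∂(μ : Measure ℝ)) := by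
  obtain ⟨-, H, hH, hmod⟩ := h
  obtain ⟨s, hs, hind⟩ := exists_testFun_index
  have hmod' := fun p => hmod (testFun p) (s p) p.1 (hind p) (abs_testFun_le p)
  choose c hc g hg hgm using hmod'
  refine ⟨g, ?_, hgm⟩
  have hP : Partrec fun z : TestCode × ℕ => (H (s z.1, z.1.1)).bind fun c => c.eval z.2 := by
    refine Partrec.bind (hH.comp ((hs.comp Computable.fst).pair
      (Computable.fst.comp Computable.fst))) ?_
    exact Nat.Partrec.Code.eval_part.comp Computable.snd (Computable.snd.comp Computable.fst)
  exact hP.of_eq_tot fun z => Part.mem_bind (hc z.1) (hg z.1 z.2)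

theorem exists_Ioo_index :
    ∃ u : ℕ → Code, Computable u ∧ ∀ N : ℕ, IndexesOpen (u N) (Set.Ioo (-(N : ℝ)) N) := by
  classical
  let P : ℕ × ℕ → Prop := fun z => ¬ rat z.2.unpair.1 < rat z.2.unpair.2 ∨
    (¬ rat z.2.unpair.1 < rat (ratNeg (ratMk z.1 0 0)) ∧ ¬ rat (ratMk z.1 0 0) < rat z.2.unpair.2)
  have hP : PrimrecPred P := by
    have h1 : Primrec fun z : ℕ × ℕ => z.2.unpair.1 := primrec_unpairFst Primrec.snd
    have h2 : Primrec fun z : ℕ × ℕ => z.2.unpair.2 := primrec_unpairSnd Primrec.snd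
    have h3 : Primrec fun z : ℕ × ℕ => ratMk z.1 0 0 :=
      primrec_ratMk Primrec.fst (Primrec.const 0) (Primrec.const 0)
    exact (primrecPred_ratLt h1 h2).not.or ((primrecPred_ratLt h1 (primrec_ratNeg h3)).not.and
      (primrecPred_ratLt h3 h2).not)
  have hF : Partrec₂ fun (N i : ℕ) => ((if P (N, i) then some 0 else none : Option ℕ) : Part ℕ) :=
    Computable.ofOption (Primrec.ite hP (Primrec.const _) (Primrec.const _)).to_comp
  obtain ⟨u, hu, huF⟩ := exists_computable_index hF
  refine ⟨u, hu, fun N => ⟨isOpen_Ioo, fun i => ?_⟩⟩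
  rw [huF, Set.mem_ofPred_eq]
  have hdom : (((if P (N, i) then some 0 else none : Option ℕ) : Part ℕ)).Dom ↔ P (N, i) := by
    split_ifs with h <;> simp [h]
  rw [hdom]
  simp only [P, openInterval, rat_ratNeg, rat_ratMk]
  by_cases hab : rat i.unpair.1 < rat i.unpair.2
  · rw [Set.Ioo_subset_Ioo_iff (by exact_mod_cast hab)]
    simp only [hab, not_true, false_or, not_lt]
    rw [← Rat.cast_le (K := ℝ), ← Rat.cast_le (K := ℝ)]
    push_cast
    simp
  · simp only [hab, not_false_iff, true_or, iff_true]
    rw [Set.Ioo_eq_empty (by exact_mod_cast hab)]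
    exact Set.empty_subset _

/-- For a uniformly computable sequence of measures it is semidecidable, up to a factor `4`, whether
the mass outside `(-N, N)` is small: the total mass is computable and the mass of `(-N, N)` can be
approximated from below. -/
theorem UniformlyComputable.exists_semidecision {μs : ℕ → FiniteMeasure ℝ}
    (h : UniformlyComputable μs) :
    ∃ T : ℕ × ℕ × ℕ →. ℕ, Partrec T ∧ ∀ n N j,
      ((T (n, N, j)).Dom → (μs n : Measure ℝ).real (Set.Ioo (-(N : ℝ)) N)ᶜ < 2 * (2 : ℝ)⁻¹ ^ j) ∧
      ((μs n : Measure ℝ).real (Set.Ioo (-(N : ℝ)) N)ᶜ < (2 : ℝ)⁻¹ ^ (j + 1) →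
        (T (n, N, j)).Dom) := by
  obtain ⟨⟨t, ht, htn⟩, H, hH, hHn⟩ := h
  obtain ⟨u, hu, hopen⟩ := exists_Ioo_index
  refine ⟨fun z => (t z.1).bind fun c => (c.eval (z.2.2 + 3)).bind fun q =>
    (H (z.1, u z.2.1)).bind fun c' => c'.eval (ratAdd q (ratNeg (ratHalfPow z.2.2))), ?_, ?_⟩
  · refine Partrec.bind (ht.comp Computable.fst) (Partrec.bind (β := ℕ) ?_
      (Partrec.bind (β := Code) ?_ ?_))
    · exact Nat.Partrec.Code.eval_part.comp Computable.snd (Primrec.to_comp (primrec_addConst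
        (Primrec.snd.comp (Primrec.snd.comp Primrec.fst)) 3))
    · have h1 : Computable fun a : ((ℕ × ℕ × ℕ) × Code) × ℕ => a.1.1.1 :=
        (Primrec.fst.comp (Primrec.fst.comp Primrec.fst)).to_comp
      have h2 : Computable fun a : ((ℕ × ℕ × ℕ) × Code) × ℕ => a.1.1.2.1 :=
        (Primrec.fst.comp (Primrec.snd.comp (Primrec.fst.comp Primrec.fst))).to_comp
      exact hH.comp (h1.pair (hu.comp h2))
    · have h1 : Primrec fun a : (((ℕ × ℕ × ℕ) × Code) × ℕ) × Code =>
          ratAdd a.1.2 (ratNeg (ratHalfPow a.1.1.1.2.2)) :=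
        primrec_ratAdd (Primrec.snd.comp Primrec.fst) (primrec_ratNeg (primrec_ratHalfPow
          (Primrec.snd.comp (Primrec.snd.comp (Primrec.fst.comp (Primrec.fst.comp Primrec.fst))))))
      exact Nat.Partrec.Code.eval_part.comp Computable.snd h1.to_comp
  · intro n N j
    obtain ⟨c, hc, ρ, hρ, hname⟩ := htn n
    obtain ⟨c', hc', hcut⟩ := hHn n _ _ (hopen N)
    have hdom : ((t n).bind fun c => (c.eval (j + 3)).bind fun q =>
        (H (n, u N)).bind fun c' => c'.eval (ratAdd q (ratNeg (ratHalfPow j)))).Dom ↔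
        (rat (ratAdd (ρ (j + 3)) (ratNeg (ratHalfPow j))) : ℝ) <
          (μs n : Measure ℝ).real (Set.Ioo (-(N : ℝ)) N) := by
      rw [Part.eq_some_iff.2 hc, Part.bind_some, Part.eq_some_iff.2 (hρ _), Part.bind_some,
        Part.eq_some_iff.2 hc', Part.bind_some]
      exact (hcut _).symm
    change (Part.Dom _ → _) ∧ (_ → Part.Dom _)
    simp only
    rw [hdom, rat_ratAdd, rat_ratNeg, rat_ratHalfPow, measureReal_compl measurableSet_Ioo]
    push_cast
    have h1 := abs_le.1 (hname.dist_le (j + 3))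
    have h2 : (0 : ℝ) < (2 : ℝ)⁻¹ ^ j := by positivity
    simp only [pow_succ] at h1 ⊢
    constructor <;> intro h3 <;> linarith

theorem integrable_of_abs_le {ν : Measure ℝ} [IsFiniteMeasure ν] {f : ℝ → ℝ} (hf : Continuous f)
    {C : ℝ} (hC : ∀ x, |f x| ≤ C) : Integrable f ν :=
  Integrable.of_bound hf.aestronglyMeasurable C (Eventually.of_forall hC)

theorem integrable_testFun (ν : Measure ℝ) [IsFiniteMeasure ν] (p : TestCode) :
    Integrable (testFun p) ν :=
  integrable_of_abs_le (continuous_testFun p) (abs_testFun_le p)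

theorem integrable_tail (ν : Measure ℝ) [IsFiniteMeasure ν] (N : ℕ) : Integrable (tail N) ν :=
  integrable_of_abs_le (continuous_tail N) (C := 1) fun x => by
    rw [abs_of_nonneg (tail_nonneg N x)]; exact tail_le_one N x

theorem integral_testFun_oneCode (ν : Measure ℝ) [IsFiniteMeasure ν] :
    ∫ x, testFun oneCode x ∂ν = ν.real Set.univ := by
  simp [testFun_oneCode]

theorem integral_tail (ν : Measure ℝ) [IsFiniteMeasure ν] (N : ℕ) :
    ∫ x, tail N x ∂ν
      = (∫ x, testFun oneCode x ∂ν + ∫ x, testFun (tailCode N) x ∂ν) / 2 := by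
  rw [← integral_add (integrable_testFun ν _) (integrable_testFun ν _), ← integral_div]
  simp only [testFun_oneCode, tail]

theorem integral_tail_le (ν : Measure ℝ) [IsFiniteMeasure ν] (N : ℕ) :
    ∫ x, tail (N + 1) x ∂ν ≤ ν.real (Set.Ioo (-(N : ℝ)) N)ᶜ := by
  rw [← integral_indicator_one measurableSet_Ioo.compl]
  refine integral_mono (integrable_tail ν _)
    ((integrable_const (1 : ℝ)).indicator measurableSet_Ioo.compl) fun x => ?_
  by_cases hx : x ∈ Set.Ioo (-(N : ℝ)) N
  · rw [tail_eq_zero (by push_cast; linarith [abs_lt.2 hx])]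
    exact Set.indicator_nonneg (fun _ _ => zero_le_one) _
  · rw [Set.indicator_of_mem hx]
    exact tail_le_one _ _

theorem measureReal_compl_le_integral_tail (ν : Measure ℝ) [IsFiniteMeasure ν] (N : ℕ) :
    ν.real (Set.Ioo (-((N + 1 : ℕ) : ℝ)) (N + 1 : ℕ))ᶜ ≤ ∫ x, tail N x ∂ν := by
  rw [← integral_indicator_one measurableSet_Ioo.compl]
  refine integral_mono ((integrable_const (1 : ℝ)).indicator measurableSet_Ioo.compl)
    (integrable_tail ν _) fun x => ?_
  by_cases hx : x ∈ Set.Ioo (-((N + 1 : ℕ) : ℝ)) (N + 1 : ℕ)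
  · rw [Set.indicator_of_notMem (by simpa using hx)]
    exact tail_nonneg _ _
  · rw [Set.indicator_of_mem hx, tail_eq_one]
    · rfl
    · have := mt abs_lt.1 hx
      push_cast at this
      linarith

theorem tendsto_integral_tail (ν : Measure ℝ) [IsFiniteMeasure ν] :
    Tendsto (fun N => ∫ x, tail N x ∂ν) atTop (𝓝 0) := by
  have := tendsto_integral_of_dominated_convergence (μ := ν) (F := tail) (f := fun _ => (0 : ℝ))
    (fun _ => 1) (fun N => (continuous_tail N).aestronglyMeasurable) (integrable_const _)
    (fun N => Eventually.of_forall fun x => by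
      rw [Real.norm_eq_abs, abs_of_nonneg (tail_nonneg N x)]; exact tail_le_one N x)
    (Eventually.of_forall fun x => by
      obtain ⟨N, hN⟩ := exists_nat_ge (|x| + 1)
      refine tendsto_const_nhds.congr' ?_
      filter_upwards [eventually_ge_atTop N] with n hn
      have : (N : ℝ) ≤ n := by exact_mod_cast hn
      rw [tail_eq_zero (by linarith)])
  simpa using this

section Moduli

variable {μs : ℕ → FiniteMeasure ℝ} {μ : FiniteMeasure ℝ} {m : TestCode → ℕ → ℕ}

theorem exists_mass_bound (hm : ∀ p, IsModulus (m p)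
      (fun n => ∫ x, testFun p x ∂(μs n : Measure ℝ)) (∫ x, testFun p x ∂(μ : Measure ℝ))) :
    ∃ M : ℕ, (∀ n, (μs n : Measure ℝ).real Set.univ ≤ M) ∧
      (μ : Measure ℝ).real Set.univ ≤ M := by
  have ht := (hm oneCode).tendsto
  simp only [integral_testFun_oneCode] at ht
  obtain ⟨b, hb⟩ := ht.bddAbove_range
  obtain ⟨M, hM⟩ := exists_nat_ge b
  have h1 : ∀ n, (μs n : Measure ℝ).real Set.univ ≤ M := fun n => (hb ⟨n, rfl⟩).trans hM
  exact ⟨M, h1, le_of_tendsto' ht h1⟩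

/-- Past the moduli for the tail function and for the total mass, a small tail at one time `n` is a
small tail at all later times and in the limit. -/
theorem integral_tail_lt_of_modulus (hm : ∀ p, IsModulus (m p)
      (fun n => ∫ x, testFun p x ∂(μs n : Measure ℝ)) (∫ x, testFun p x ∂(μ : Measure ℝ)))
    {N n j : ℕ} (h1 : m (tailCode (N + 1)) j ≤ n) (h2 : m oneCode j ≤ n)
    (h3 : (μs n : Measure ℝ).real (Set.Ioo (-(N : ℝ)) N)ᶜ < 2 * (2 : ℝ)⁻¹ ^ j) :
    (∀ i, n ≤ i → ∫ x, tail (N + 1) x ∂(μs i : Measure ℝ) < 4 * (2 : ℝ)⁻¹ ^ j) ∧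
      ∫ x, tail (N + 1) x ∂(μ : Measure ℝ) < 4 * (2 : ℝ)⁻¹ ^ j := by
  have h4 := integral_tail_le (μs n : Measure ℝ) N
  have key : ∀ i, n ≤ i → |∫ x, tail (N + 1) x ∂(μs i : Measure ℝ)
      - ∫ x, tail (N + 1) x ∂(μ : Measure ℝ)| < (2 : ℝ)⁻¹ ^ j := by
    intro i hi
    have h5 := abs_lt.1 (hm _ j i (h1.trans hi))
    have h6 := abs_lt.1 (hm _ j i (h2.trans hi))
    rw [integral_tail, integral_tail, abs_lt]
    constructor <;> linarith
  have h7 := abs_lt.1 (key n le_rfl)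
  refine ⟨fun i hi => ?_, by linarith⟩
  have := abs_lt.1 (key i hi)
  linarith

/-- A sequence with convergent integrals of test functions is tight. -/
theorem exists_eventually_measureReal_compl_lt (hm : ∀ p, IsModulus (m p)
      (fun n => ∫ x, testFun p x ∂(μs n : Measure ℝ)) (∫ x, testFun p x ∂(μ : Measure ℝ)))
    {ε : ℝ} (hε : 0 < ε) : ∃ N : ℕ, ∀ᶠ n in atTop,
      (μs n : Measure ℝ).real (Set.Ioo (-(N : ℝ)) N)ᶜ < ε := by
  obtain ⟨N, hN⟩ := ((tendsto_integral_tail (μ : Measure ℝ)).eventually (gt_mem_nhds hε)).exists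
  have hlim : Tendsto (fun n => ∫ x, tail N x ∂(μs n : Measure ℝ)) atTop
      (𝓝 (∫ x, tail N x ∂(μ : Measure ℝ))) := by
    simp only [integral_tail]
    exact ((hm _).tendsto.add (hm _).tendsto).div_const 2
  refine ⟨N + 1, (hlim.eventually (gt_mem_nhds hN)).mono fun n hn => ?_⟩
  exact (measureReal_compl_le_integral_tail _ N).trans_lt hn

end Moduli

/-! ### A modulus from a compact-open name -/

/-- The code of the statement that, on the `i`-th grid cell of length `1 / (D + 1)` starting from
`-(N + 2)`, a function is `2⁻¹ ^ j`-close to the value of the test function `p` at the left end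
point. -/
def closeCode (p : TestCode) (N D j i : ℕ) : ℕ :=
  let x := gridPoint (ratNeg (ratMk (N + 2) 0 0)) D i
  Nat.pair (Nat.pair x (gridPoint (ratNeg (ratMk (N + 2) 0 0)) D (i + 1)))
    (Nat.pair (ratAdd (testFunRat p x) (ratNeg (ratHalfPow j)))
      (ratAdd (testFunRat p x) (ratHalfPow j)))

/-- The number of grid cells of length `1 / (D + 1)` needed to cover `[-(N + 2), N + 2]`. -/
def cellCount (N D : ℕ) : ℕ := 2 * (N + 2) * (D + 1) + 1

theorem memSubbasic_closeCode_iff {f : ℝ → ℝ} {p : TestCode} {N D j i : ℕ} :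
    MemSubbasic f (closeCode p N D j i) ↔
      ∀ x : ℝ, -((N : ℝ) + 2) + i / ((D : ℝ) + 1) ≤ x →
        x ≤ -((N : ℝ) + 2) + i / ((D : ℝ) + 1) + 1 / ((D : ℝ) + 1) →
        |f x - testFun p (-((N : ℝ) + 2) + i / ((D : ℝ) + 1))| < (2 : ℝ)⁻¹ ^ j := by
  have h1 : ((rat (gridPoint (ratNeg (ratMk (N + 2) 0 0)) D i) : ℚ) : ℝ)
      = -((N : ℝ) + 2) + i / ((D : ℝ) + 1) := by
    rw [rat_gridPoint, rat_ratNeg, rat_ratMk]; push_cast; simp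
  have h2 : ((rat (gridPoint (ratNeg (ratMk (N + 2) 0 0)) D (i + 1)) : ℚ) : ℝ)
      = -((N : ℝ) + 2) + i / ((D : ℝ) + 1) + 1 / ((D : ℝ) + 1) := by
    rw [rat_gridPoint, rat_ratNeg, rat_ratMk]; push_cast; simp; ring
  have h3 : rat (gridPoint (ratNeg (ratMk (N + 2) 0 0)) D i)
      ≤ rat (gridPoint (ratNeg (ratMk (N + 2) 0 0)) D (i + 1)) := by
    rw [← Rat.cast_le (K := ℝ), h1, h2]
    linarith [show (0 : ℝ) ≤ 1 / ((D : ℝ) + 1) by positivity]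
  simp only [MemSubbasic, closeCode, openInterval, Nat.unpair_pair, h3, true_and, h1, h2,
    rat_ratAdd, Rat.cast_add, rat_testFunRat, rat_ratNeg, rat_ratHalfPow, Set.image_subset_iff]
  push_cast
  constructor
  · intro h x hx1 hx2
    have := h ⟨hx1, hx2⟩
    rw [abs_lt]
    exact ⟨by linarith [this.1], by linarith [this.2]⟩
  · rintro h x ⟨hx1, hx2⟩
    have := abs_lt.1 (h x hx1 hx2)
    exact ⟨by linarith, by linarith⟩

/-- Closeness on all grid cells makes the test function close to `f` on `[-(N + 2), N + 2]`; outside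
of it, the tail function is `1`. -/
theorem abs_sub_testFun_le {f : ℝ → ℝ} {p : TestCode} (hB : ∀ x, |f x| ≤ p.1) {N D j : ℕ}
    (hD : p.2.1 * 2 ^ j ≤ D + 1)
    (hclose : ∀ i < cellCount N D, MemSubbasic f (closeCode p N D j i)) (x : ℝ) :
    |f x - testFun p x| ≤ 2 * (2 : ℝ)⁻¹ ^ j + 2 * p.1 * tail (N + 1) x := by
  have hD0 : (0 : ℝ) < (D : ℝ) + 1 := by positivity
  rcases le_or_gt ((N : ℝ) + 2) |x| with hx | hx
  · rw [tail_eq_one (by push_cast; linarith)]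
    have h1 := abs_sub (f x) (testFun p x)
    have h2 := hB x
    have h3 := abs_testFun_le p x
    have h4 : (0 : ℝ) ≤ (2 : ℝ)⁻¹ ^ j := by positivity
    linarith
  · have hx' := abs_lt.1 hx
    have ha : ((rat (ratNeg (ratMk (N + 2) 0 0)) : ℚ) : ℝ) = -((N : ℝ) + 2) := by
      rw [rat_ratNeg, rat_ratMk]; push_cast; simp
    obtain ⟨i, hi, hxi⟩ := exists_mem_gridCell (a := ratNeg (ratMk (N + 2) 0 0)) (D := D)
      (N := cellCount N D) (x := x) (by rw [ha]; exact hx'.1.le) (by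
        rw [rat_gridPoint]
        push_cast
        rw [ha, cellCount]
        push_cast
        rw [add_div, mul_div_assoc, div_self hD0.ne']
        have : (0 : ℝ) < 1 / ((D : ℝ) + 1) := by positivity
        linarith)
    rw [rat_gridPoint, rat_gridPoint, Set.mem_Icc] at hxi
    push_cast at hxi
    rw [ha, add_div] at hxi
    obtain ⟨h1, h2⟩ := hxi
    have h3 := memSubbasic_closeCode_iff.1 (hclose i hi) x h1 (by linarith)
    have h4 := abs_testFun_sub_le p (-((N : ℝ) + 2) + i / ((D : ℝ) + 1)) x
    have h5 : |(-((N : ℝ) + 2) + i / ((D : ℝ) + 1)) - x| ≤ 1 / ((D : ℝ) + 1) :=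
      abs_le.2 ⟨by linarith, by linarith⟩
    have h6 : (p.2.1 : ℝ) * (1 / ((D : ℝ) + 1)) ≤ (2 : ℝ)⁻¹ ^ j := by
      rw [mul_one_div, div_le_iff₀ hD0, inv_pow, ← div_eq_inv_mul, le_div_iff₀ (by positivity)]
      exact_mod_cast hD
    have h7 := mul_le_mul_of_nonneg_left h5 (Nat.cast_nonneg (α := ℝ) p.2.1)
    have h8 := abs_sub_le (f x) (testFun p (-((N : ℝ) + 2) + i / ((D : ℝ) + 1))) (testFun p x)
    have h9 := mul_nonneg (Nat.cast_nonneg (α := ℝ) p.1) (tail_nonneg (N + 1) x)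
    linarith

theorem abs_integral_sub_testFun_le (ν : Measure ℝ) [IsFiniteMeasure ν] {f : ℝ → ℝ}
    (hf : Continuous f) {p : TestCode} (hB : ∀ x, |f x| ≤ p.1) {M N : ℕ}
    (hM : ν.real Set.univ ≤ M) {ε : ℝ} (hε : 0 ≤ ε)
    (hfp : ∀ x, |f x - testFun p x| ≤ 2 * ε + 2 * p.1 * tail (N + 1) x)
    (htail : ∫ x, tail (N + 1) x ∂ν ≤ 4 * ε) :
    |∫ x, f x ∂ν - ∫ x, testFun p x ∂ν| ≤ (2 * M + 8 * p.1) * ε := by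
  rw [← integral_sub (integrable_of_abs_le hf hB) (integrable_testFun ν p)]
  have hint : Integrable (fun x => 2 * ε + 2 * (p.1 : ℝ) * tail (N + 1) x) ν :=
    (integrable_const _).add ((integrable_tail ν _).const_mul _)
  calc |∫ x, (f x - testFun p x) ∂ν| ≤ ∫ x, |f x - testFun p x| ∂ν := abs_integral_le_integral_abs
    _ ≤ ∫ x, (2 * ε + 2 * (p.1 : ℝ) * tail (N + 1) x) ∂ν :=
      integral_mono ((integrable_of_abs_le hf hB).sub (integrable_testFun ν p)).abs hint hfp
    _ = 2 * ε * ν.real Set.univ + 2 * (p.1 : ℝ) * ∫ x, tail (N + 1) x ∂ν := by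
      rw [integral_add (integrable_const _) ((integrable_tail ν _).const_mul _),
        integral_const_mul (2 * (p.1 : ℝ)), integral_const, smul_eq_mul,
        mul_comm (2 * ε) (ν.real Set.univ)]
    _ ≤ 2 * ε * M + 2 * (p.1 : ℝ) * (4 * ε) := by gcongr
    _ = (2 * M + 8 * p.1) * ε := by ring

/-- The data `(N, n, L, ℓ, D)` that the search for a modulus goes through: a cut-off `N`, a time
`n`, a Lipschitz constant and a list for a test function, and a grid size. -/
abbrev SearchData : Type := ℕ × ℕ × ℕ × List (ℕ × ℕ) × ℕ

/-- The test function of the search data has a small enough Lipschitz constant for the grid, and the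
oracle segment `σ` witnesses that it is close to `f`. -/
def IsClose (σ : List ℕ) (B j : ℕ) (d : SearchData) : Prop :=
  d.2.2.1 * 2 ^ j ≤ d.2.2.2.2 + 1 ∧
    ∀ i < cellCount d.1 d.2.2.2.2, closeCode (B, d.2.2.1, d.2.2.2.1) d.1 d.2.2.2.2 j i ∈ σ

theorem primrecPred_isClose {α : Type*} [Primcodable α] {σ : α → List ℕ} {B j : α → ℕ}
    {d : α → SearchData} (hσ : Primrec σ) (hB : Primrec B) (hj : Primrec j) (hd : Primrec d) :
    PrimrecPred fun a => IsClose (σ a) (B a) (j a) (d a) := by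
  have hN := Primrec.fst.comp hd
  have hL := Primrec.fst.comp (Primrec.snd.comp (Primrec.snd.comp hd))
  have hl := Primrec.fst.comp (Primrec.snd.comp (Primrec.snd.comp (Primrec.snd.comp hd)))
  have hD := Primrec.snd.comp (Primrec.snd.comp (Primrec.snd.comp (Primrec.snd.comp hd)))
  have hp : Primrec fun a => ((B a, (d a).2.2.1, (d a).2.2.2.1) : TestCode) := hB.pair (hL.pair hl)
  have ha : Primrec fun a => ratNeg (ratMk ((d a).1 + 2) 0 0) :=
    primrec_ratNeg (primrec_ratMk (primrec_addConst hN 2) (Primrec.const 0) (Primrec.const 0))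
  have hcount : Primrec fun a => cellCount (d a).1 (d a).2.2.2.2 :=
    primrec_addConst (primrec_mul (primrec_mul (Primrec.const 2) (primrec_addConst hN 2))
      (primrec_addConst hD 1)) 1
  refine (Primrec.nat_le.comp (primrec_mul hL (primrec_natPow.comp (Primrec.const 2) hj))
    (primrec_addConst hD 1)).and (primrecPred_forall_lt ?_ hcount)
  have hx : Primrec fun q : α × ℕ =>
      gridPoint (ratNeg (ratMk ((d q.1).1 + 2) 0 0)) (d q.1).2.2.2.2 q.2 :=
    primrec_gridPoint (ha.comp Primrec.fst) (hD.comp Primrec.fst) Primrec.snd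
  have hx' : Primrec fun q : α × ℕ =>
      gridPoint (ratNeg (ratMk ((d q.1).1 + 2) 0 0)) (d q.1).2.2.2.2 (q.2 + 1) :=
    primrec_gridPoint (ha.comp Primrec.fst) (hD.comp Primrec.fst) (primrec_addConst Primrec.snd 1)
  have hy := primrec_testFunRat.comp (hp.comp Primrec.fst) hx
  have he : Primrec fun q : α × ℕ => ratHalfPow (j q.1) := primrec_ratHalfPow (hj.comp Primrec.fst)
  have hcode : Primrec fun q : α × ℕ =>
      closeCode (B q.1, (d q.1).2.2.1, (d q.1).2.2.2.1) (d q.1).1 (d q.1).2.2.2.2 (j q.1) q.2 :=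
    Primrec₂.natPair.comp (Primrec₂.natPair.comp hx hx') (Primrec₂.natPair.comp
      (primrec_ratAdd hy (primrec_ratNeg he)) (primrec_ratAdd hy he))
  exact ((PrimrecRel.exists_mem_list (R := fun a b : ℕ => a = b) Primrec.eq).comp
    (hσ.comp Primrec.fst) hcode).of_eq fun q => by simp

/-- Suitable search data exist for every compact-open name: the name lists all correct statements of
closeness, and finitely many of them are needed. -/
theorem exists_isClose {f : ℝ → ℝ} (hf : Continuous f) {ρ : ℕ → ℕ} (hρ : IsCompactOpenName ρ f)
    {B : ℕ} (hB : ∀ x, |f x| ≤ B) (N n j : ℕ) :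
    ∃ (k L : ℕ) (ℓ : List (ℕ × ℕ)) (D : ℕ), IsClose (initSeg ρ k) B j (N, n, L, ℓ, D) := by
  have hε : (0 : ℝ) < (2 : ℝ)⁻¹ ^ j := by positivity
  obtain ⟨L, ℓ, happ⟩ := exists_testFun_approx hf hB (-((N : ℝ) + 2)) ((N : ℝ) + 3)
    (ε := (2 : ℝ)⁻¹ ^ j / 4) (by positivity)
  -- on a grid cell, the test function varies by at most `2⁻¹ ^ j / 2`
  set D := L * 2 ^ (j + 1) with hDdef
  have hD0 : (0 : ℝ) < (D : ℝ) + 1 := by positivity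
  have hD1 : 1 / ((D : ℝ) + 1) ≤ 1 := by
    rw [div_le_one hD0]; linarith [Nat.cast_nonneg (α := ℝ) D]
  have hLD : (L : ℝ) * (1 / ((D : ℝ) + 1)) ≤ (2 : ℝ)⁻¹ ^ j / 2 := by
    rw [mul_one_div, div_le_iff₀ hD0, hDdef]
    push_cast
    have : (2 : ℝ)⁻¹ ^ j * 2 ^ j = 1 := by rw [← mul_pow]; norm_num
    rw [pow_succ]
    nlinarith
  have hmem : ∀ i < cellCount N D, ∃ z, ρ z = closeCode (B, L, ℓ) N D j i := by
    intro i hi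
    have hi' : (i : ℝ) / ((D : ℝ) + 1) ≤ 2 * ((N : ℝ) + 2) := by
      rw [div_le_iff₀ hD0]
      exact_mod_cast Nat.lt_succ_iff.1 hi
    have hi0 : 0 ≤ (i : ℝ) / ((D : ℝ) + 1) := by positivity
    have : closeCode (B, L, ℓ) N D j i ∈ {m | MemSubbasic f m} := by
      refine memSubbasic_closeCode_iff.2 fun x hx1 hx2 => ?_
      have h1 := happ x ⟨by linarith, by linarith⟩
      have h2 := abs_testFun_sub_le (B, L, ℓ) x (-((N : ℝ) + 2) + i / ((D : ℝ) + 1))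
      have h3 : |x - (-((N : ℝ) + 2) + i / ((D : ℝ) + 1))| ≤ 1 / ((D : ℝ) + 1) :=
        abs_le.2 ⟨by linarith [show (0 : ℝ) ≤ 1 / ((D : ℝ) + 1) by positivity], by linarith⟩
      have h4 := mul_le_mul_of_nonneg_left h3 (Nat.cast_nonneg (α := ℝ) L)
      have h5 := abs_sub_le (f x) (testFun (B, L, ℓ) x)
        (testFun (B, L, ℓ) (-((N : ℝ) + 2) + i / ((D : ℝ) + 1)))
      rw [abs_sub_comm (f x) (testFun _ x)] at h5
      simp only at h2
      linarith
    rwa [← hρ] at this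
  choose! z hz using hmem
  refine ⟨(Finset.range (cellCount N D)).sup z + 1, L, ℓ, D, ?_, fun i hi => ?_⟩
  · simp only [hDdef, pow_succ]
    nlinarith [Nat.zero_le (L * 2 ^ j)]
  · refine List.mem_map.2 ⟨z i, List.mem_range.2 (Nat.lt_succ_of_le ?_), hz i hi⟩
    exact Finset.le_sup (f := z) (Finset.mem_range.2 hi)

theorem exists_isCompactOpenName {f : ℝ → ℝ} {B : ℕ} (hB : ∀ x, |f x| ≤ B) :
    ∃ ρ, IsCompactOpenName ρ f := by
  obtain ⟨ρ, hρ⟩ := (Set.to_countable {m | MemSubbasic f m}).exists_eq_range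
    ⟨_, memSubbasic_trivialSubbasic hB⟩
  exact ⟨ρ, hρ.symm⟩

/-- The error constant: `j = k + (B + M) + 6` halvings are enough. -/
theorem error_lt (k B M : ℕ) :
    (2 * (M : ℝ) + 8 * B) * (2 : ℝ)⁻¹ ^ (k + (B + M) + 6) ≤ (2 : ℝ)⁻¹ ^ k / 8 := by
  have h1 : ((B + M : ℕ) : ℝ) ≤ 2 ^ (B + M) := by exact_mod_cast Nat.lt_two_pow_self.le
  have h2 : (2 : ℝ) ^ (B + M) * (2 : ℝ)⁻¹ ^ (B + M) = 1 := by rw [← mul_pow]; norm_num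
  have h3 : (2 * (M : ℝ) + 8 * B) * (2 : ℝ)⁻¹ ^ (B + M) ≤ 8 := by
    calc (2 * (M : ℝ) + 8 * B) * (2 : ℝ)⁻¹ ^ (B + M)
        ≤ (8 * 2 ^ (B + M)) * (2 : ℝ)⁻¹ ^ (B + M) := by
          gcongr
          push_cast at h1
          linarith [Nat.cast_nonneg (α := ℝ) M]
      _ = 8 := by rw [mul_assoc, h2, mul_one]
  have h4 : (0 : ℝ) ≤ (2 : ℝ)⁻¹ ^ k := by positivity
  calc (2 * (M : ℝ) + 8 * B) * (2 : ℝ)⁻¹ ^ (k + (B + M) + 6)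
      = ((2 * (M : ℝ) + 8 * B) * (2 : ℝ)⁻¹ ^ (B + M)) * ((2 : ℝ)⁻¹ ^ k / 64) := by
        rw [pow_add, pow_add]; ring
    _ ≤ 8 * ((2 : ℝ)⁻¹ ^ k / 64) := by gcongr
    _ = (2 : ℝ)⁻¹ ^ k / 8 := by ring

section Search

variable {μs : ℕ → FiniteMeasure ℝ} {μ : FiniteMeasure ℝ} {m : TestCode → ℕ → ℕ}

/-- The precision used to find the `k`-th value of a modulus, for functions bounded by `B` and
measures with total mass at most `M`. -/
def searchPrec (M B k : ℕ) : ℕ := k + (B + M) + 6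

/-- The test function that belongs to the search data. -/
def searchTest (B : ℕ) (d : SearchData) : TestCode := (B, d.2.2.1, d.2.2.2.1)

/-- The time at which the tail is inspected: it is past the moduli `m` of the tail function and of
the total mass. -/
def searchTime (m : TestCode → ℕ → ℕ) (j : ℕ) (d : SearchData) : ℕ :=
  max (m (tailCode (d.1 + 1)) j) (max (m oneCode j) d.2.1)

/-- The `k`-th value of a modulus that successful search data yield. -/
def searchValue (m : TestCode → ℕ → ℕ) (M B k : ℕ) (d : SearchData) : ℕ :=
  max (searchTime m (searchPrec M B k) d) (m (searchTest B d) (k + 2))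

/-- Successful search data yield a correct value of a modulus: `f` and the test function differ by
at most `2 * 2⁻¹ ^ j + 2 * B * tail (N + 1)`, and the tail has a small integral at all relevant
times. -/
theorem abs_integral_sub_lt_of_isClose (hm : ∀ p, IsModulus (m p)
      (fun n => ∫ x, testFun p x ∂(μs n : Measure ℝ)) (∫ x, testFun p x ∂(μ : Measure ℝ)))
    {M : ℕ} (hM : ∀ n, (μs n : Measure ℝ).real Set.univ ≤ M)
    (hM' : (μ : Measure ℝ).real Set.univ ≤ M)
    {f : ℝ → ℝ} (hf : Continuous f) {ρ : ℕ → ℕ} (hρ : IsCompactOpenName ρ f) {B : ℕ}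
    (hB : ∀ x, |f x| ≤ B) {l k : ℕ} {d : SearchData}
    (hclose : IsClose (initSeg ρ l) B (searchPrec M B k) d)
    (htail : (μs (searchTime m (searchPrec M B k) d) : Measure ℝ).real
      (Set.Ioo (-(d.1 : ℝ)) d.1)ᶜ < 2 * (2 : ℝ)⁻¹ ^ (searchPrec M B k))
    {n : ℕ} (hn : searchValue m M B k d ≤ n) :
    |∫ x, f x ∂(μs n : Measure ℝ) - ∫ x, f x ∂(μ : Measure ℝ)| < (2 : ℝ)⁻¹ ^ k := by
  have e4 : (2 * (M : ℝ) + 8 * B) * (2 : ℝ)⁻¹ ^ searchPrec M B k ≤ (2 : ℝ)⁻¹ ^ k / 8 :=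
    error_lt k B M
  have e3 := hm (searchTest B d) (k + 2) n ((le_max_right _ _).trans hn)
  have hn' : searchTime m (searchPrec M B k) d ≤ n := (le_max_left _ _).trans hn
  generalize searchPrec M B k = j at *
  obtain ⟨htime, htime'⟩ := integral_tail_lt_of_modulus hm (le_max_left _ _)
    ((le_max_left _ _).trans (le_max_right _ _)) htail
  have hfp := abs_sub_testFun_le (p := searchTest B d) hB hclose.1 fun i hi => by
    obtain ⟨z, -, hz⟩ := List.mem_map.1 (hclose.2 i hi)
    exact hρ.subset ⟨z, hz⟩
  have hε : (0 : ℝ) ≤ (2 : ℝ)⁻¹ ^ j := by positivity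
  have e1 := abs_le.1 ((abs_integral_sub_testFun_le (μs n : Measure ℝ) hf (p := searchTest B d) hB
    (hM n) hε hfp (htime n hn').le).trans e4)
  have e2 := abs_le.1 ((abs_integral_sub_testFun_le (μ : Measure ℝ) hf (p := searchTest B d) hB
    hM' hε hfp htime'.le).trans e4)
  have e5 : (2 : ℝ)⁻¹ ^ (k + 2) = (2 : ℝ)⁻¹ ^ k / 4 := by rw [pow_add]; norm_num; ring
  have e6 : (0 : ℝ) < (2 : ℝ)⁻¹ ^ k := by positivity
  rw [e5] at e3
  have e3 := abs_lt.1 e3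
  rw [abs_lt]
  constructor <;> linarith

open Classical in
/-- One attempt, with data `d`, to find the `k`-th value of a modulus from the segment `σ` of a
compact-open name: it succeeds if the data are close to the named function and the semidecision
procedure `T` confirms that the tail is small. -/
noncomputable def searchStep (m : TestCode → ℕ → ℕ) (T : ℕ × ℕ × ℕ →. ℕ) (M : ℕ) (σ : List ℕ)
    (B k : ℕ) (d : SearchData) : Part ℕ :=
  ((if IsClose σ B (searchPrec M B k) d then some 0 else none : Option ℕ) : Part ℕ).bind fun _ =>
    (T (searchTime m (searchPrec M B k) d, d.1, searchPrec M B k)).map fun _ =>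
      searchValue m M B k d

theorem mem_searchStep {T : ℕ × ℕ × ℕ →. ℕ} {M : ℕ} {σ : List ℕ} {B k : ℕ} {d : SearchData} {y : ℕ}
    (h : y ∈ searchStep m T M σ B k d) : IsClose σ B (searchPrec M B k) d ∧
      (T (searchTime m (searchPrec M B k) d, d.1, searchPrec M B k)).Dom ∧
      y = searchValue m M B k d := by
  obtain ⟨_, hclose, hy⟩ := Part.mem_bind_iff.1 h
  obtain ⟨b, hb, rfl⟩ := (Part.mem_map_iff _).1 hy
  refine ⟨?_, Part.dom_iff_mem.2 ⟨b, hb⟩, rfl⟩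
  by_contra hcon
  simp [hcon] at hclose

theorem searchStep_dom {T : ℕ × ℕ × ℕ →. ℕ} {M : ℕ} {σ : List ℕ} {B k : ℕ} {d : SearchData}
    (h1 : IsClose σ B (searchPrec M B k) d)
    (h2 : (T (searchTime m (searchPrec M B k) d, d.1, searchPrec M B k)).Dom) :
    (searchStep m T M σ B k d).Dom := by
  rw [searchStep, if_pos h1, Part.coe_some, Part.bind_some]
  exact h2

theorem partrec_searchStep (hm : Computable₂ m) {T : ℕ × ℕ × ℕ →. ℕ} (hT : Partrec T) (M : ℕ)
    {α : Type*} [Primcodable α] {σ : α → List ℕ} {B k : α → ℕ} {d : α → SearchData}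
    (hσ : Primrec σ) (hB : Primrec B) (hk : Primrec k) (hd : Primrec d) :
    Partrec fun a => searchStep m T M (σ a) (B a) (k a) (d a) := by
  classical
  have hj : Primrec fun a => searchPrec M (B a) (k a) :=
    primrec_addConst (primrec_add hk (primrec_addConst hB M)) 6
  have hN := Primrec.fst.comp hd
  have htest : Primrec fun a => searchTest (B a) (d a) :=
    hB.pair ((Primrec.fst.comp (Primrec.snd.comp (Primrec.snd.comp hd))).pair
      (Primrec.fst.comp (Primrec.snd.comp (Primrec.snd.comp (Primrec.snd.comp hd)))))
  have htime : Computable fun a => searchTime m (searchPrec M (B a) (k a)) (d a) :=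
    Primrec.nat_max.to_comp.comp
      (hm.comp (primrec_tailCode.comp (primrec_addConst hN 1)).to_comp hj.to_comp)
      (Primrec.nat_max.to_comp.comp (hm.comp (Computable.const oneCode) hj.to_comp)
        (Primrec.fst.comp (Primrec.snd.comp hd)).to_comp)
  have hout : Computable fun a => searchValue m M (B a) (k a) (d a) :=
    Primrec.nat_max.to_comp.comp htime (hm.comp htest.to_comp (primrec_addConst hk 2).to_comp)
  have hcheck : Primrec fun a =>
      (if IsClose (σ a) (B a) (searchPrec M (B a) (k a)) (d a) then some 0 else none : Option ℕ) :=
    Primrec.ite (primrecPred_isClose hσ hB hj hd) (Primrec.const _) (Primrec.const _)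
  have hrest : Partrec fun a => (T (searchTime m (searchPrec M (B a) (k a)) (d a), (d a).1,
      searchPrec M (B a) (k a))).map fun _ => searchValue m M (B a) (k a) (d a) :=
    (hT.comp (htime.pair (hN.to_comp.pair hj.to_comp))).map (hout.comp Computable.fst)
  refine (Partrec.bind (Computable.ofOption hcheck.to_comp)
    (hrest.comp Computable.fst).to₂).of_eq fun a => ?_
  unfold searchStep
  congr

end Search

theorem EffectivelyWeaklyConverges.uniformlyEffectivelyWeaklyConverges
    {μs : ℕ → FiniteMeasure ℝ} (hμs : UniformlyComputable μs) {μ : FiniteMeasure ℝ}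
    (h : EffectivelyWeaklyConverges μs μ) : UniformlyEffectivelyWeaklyConverges μs μ := by
  obtain ⟨m, hmc, hm⟩ := h.exists_testFun_modulus
  obtain ⟨T, hT, hTdom⟩ := hμs.exists_semidecision
  obtain ⟨M, hM, hM'⟩ := exists_mass_bound hm
  have hG : Partrec₂ fun (z : List ℕ × ℕ) (w : ℕ) => searchStep m T M z.1 z.2.unpair.1
      z.2.unpair.2 ((Encodable.decode (α := SearchData) w).getD (0, 0, 0, [], 0)) :=
    partrec_searchStep hmc hT M (Primrec.fst.comp Primrec.fst)
      (primrec_unpairFst (Primrec.snd.comp Primrec.fst))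
      (primrec_unpairSnd (Primrec.snd.comp Primrec.fst))
      (Primrec.option_getD.comp (Primrec.decode.comp Primrec.snd) (Primrec.const _))
  obtain ⟨F, hF, hFG, hFdom⟩ := exists_partrec_select hG
  have hF' : Partrec₂ fun (_ : Unit) (z : List ℕ × ℕ) => F z := hF.comp Computable.snd
  obtain ⟨s, -, hs⟩ := exists_functional_index hF'
  -- every output of the search is a correct value of a modulus
  have hsound : ∀ (f : ℝ → ℝ) (ρ : ℕ → ℕ) (B k : ℕ), Continuous f → IsCompactOpenName ρ f →
      (∀ x, |f x| ≤ B) → ∀ y ∈ functional (s ()) ρ (Nat.pair B k), ∀ n, y ≤ n →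
        |∫ x, f x ∂(μs n : Measure ℝ) - ∫ x, f x ∂(μ : Measure ℝ)| < (2 : ℝ)⁻¹ ^ k := by
    intro f ρ B k hf hρ hB y hy n hn
    obtain ⟨l, hl⟩ := (hs () ρ (Nat.pair B k)).1 y hy
    obtain ⟨w, hw⟩ := hFG _ y hl
    rw [Nat.unpair_pair] at hw
    obtain ⟨hclose, hd, rfl⟩ := mem_searchStep hw
    exact abs_integral_sub_lt_of_isClose hm hM hM' hf hρ hB hclose ((hTdom _ _ _).1 hd) hn
  -- the search halts for every compact-open name
  have hcomplete : ∀ (f : ℝ → ℝ) (ρ : ℕ → ℕ) (B k : ℕ), Continuous f → IsCompactOpenName ρ f →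
      (∀ x, |f x| ≤ B) → (functional (s ()) ρ (Nat.pair B k)).Dom := by
    intro f ρ B k hf hρ hB
    obtain ⟨N, hN⟩ := exists_eventually_measureReal_compl_lt hm
      (ε := (2 : ℝ)⁻¹ ^ (searchPrec M B k + 1)) (by positivity)
    obtain ⟨n, hn⟩ := eventually_atTop.1 hN
    obtain ⟨l, L, ℓ, D, hclose⟩ := exists_isClose hf hρ hB N n (searchPrec M B k)
    refine (hs () ρ (Nat.pair B k)).2 l
      (hFdom _ (Encodable.encode ((N, n, L, ℓ, D) : SearchData)) ?_)
    rw [Encodable.encodek, Option.getD_some, Nat.unpair_pair]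
    exact searchStep_dom hclose ((hTdom _ _ _).2 (hn _ ((le_max_right _ _).trans
      (le_max_right _ _))))
  have huniform : ∀ (f : ℝ → ℝ) (ρ : ℕ → ℕ) (B : ℕ), Continuous f → IsCompactOpenName ρ f →
      (∀ x, |f x| ≤ B) → ∃ g : ℕ → ℕ, (∀ k, g k ∈ functional (s ()) ρ (Nat.pair B k)) ∧
        IsModulus g (fun n => ∫ x, f x ∂(μs n : Measure ℝ)) (∫ x, f x ∂(μ : Measure ℝ)) := by
    intro f ρ B hf hρ hB
    have hex := fun k => Part.dom_iff_mem.1 (hcomplete f ρ B k hf hρ hB)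
    choose g hg using hex
    exact ⟨g, hg, fun k n hn => hsound f ρ B k hf hρ hB _ (hg k) n hn⟩
  refine ⟨FiniteMeasure.tendsto_iff_forall_integral_tendsto.2 fun f => ?_, s (), huniform⟩
  obtain ⟨B, hB⟩ := exists_nat_ge ‖f‖
  have hB' : ∀ x, |f x| ≤ B := fun x => (f.norm_coe_le_norm x).trans hB
  obtain ⟨ρ, hρ⟩ := exists_isCompactOpenName hB'
  obtain ⟨g, -, hg⟩ := huniform f ρ B f.continuous hρ hB'
  exact hg.tendsto

end EffWeak

theorem theorem4p3 (μs : ℕ → MeasureTheory.FiniteMeasure ℝ)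
    (hμs : EffWeak.UniformlyComputable μs) :
    (∀ μ : MeasureTheory.FiniteMeasure ℝ,
      EffWeak.EffectivelyWeaklyConverges μs μ ↔
        EffWeak.UniformlyEffectivelyWeaklyConverges μs μ) ∧
    ((∃ μ : MeasureTheory.FiniteMeasure ℝ, EffWeak.EffectivelyWeaklyConverges μs μ) ↔
      ∃ μ : MeasureTheory.FiniteMeasure ℝ,
        EffWeak.UniformlyEffectivelyWeaklyConverges μs μ) := by
  have h : ∀ μ : MeasureTheory.FiniteMeasure ℝ, EffWeak.EffectivelyWeaklyConverges μs μ ↔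
      EffWeak.UniformlyEffectivelyWeaklyConverges μs μ := fun μ =>
    ⟨fun h => h.uniformlyEffectivelyWeaklyConverges hμs, fun h => h.effectivelyWeaklyConverges⟩
  exact ⟨h, exists_congr h⟩
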